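/- \textbf{Proposition (Reduction of the dKdV equation on warped products).} All objects are smooth. Let $M=\prod_{j=1}^k M_j$ be a connected product of manifolds of positive dimension, with a pseudo-Riemannian metric $g$. For $p\in M$ let $\tau_j^{p}:M_j\to M$, $q\mapsto(p_1,\dots,p_{j-1},q,p_{j+1},\dots,p_k)$, be the embedding of $M_j$ as the leaf through $p$, and let $E_j$ be the distribution on $M$ tangent to the leaves of $M_j$. Let $K$ be a Killing tensor of $(M,g)$, i.e. a symmetric contravariant $2$-tensor whose Schouten bracket with the contravariant metric vanishes, and suppose that its eigenspaces are exactly $E_1,\dots,E_k$: there are functions $\lambda_1,\dots,\lambda_k$ on $M$ with $E_j=\ker(K-\lambda_j I)$ at every point, where $K$ is viewed as an endomorphism of $TM$. Fix $i$ and suppose that $E_i$ is a Killing distribution: it is non-degenerate, it is spherical (there is a section $H$ of $E_i^\perp$ such that, for all local sections $X,Y$ of $E_i$, the $E_i^\perp$-component of $\nabla_XY$ is $g(X,Y)H$ and the $E_i^\perp$-component of $\nabla_XH$ is $0$), and $E_i^\perp$ is geodesic ($\nabla_XY\in E_i^\perp$ for all local sections $X,Y$ of $E_i^\perp$). Here $\nabla$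 is the Levi-Civita connection of $g$. Fix $\bar p\in M$, put $\tau_i=\tau_i^{\bar p}$, and let $g_i$ be a pseudo-Riemannian metric on $M_i$ which agrees, up to a positive constant factor, with the metric induced on the leaf through $\bar p$: $\tau_i^*g=c\,g_i$ with a constant $c>0$. Let $\tilde K_i$ be a Killing tensor of $(M_i,g_i)$ and let $K_i$ be its lift to $M$, $K_i|_p=(d\tau_i^{p})_*\,(\tilde K_i|_{p_i})$. Let $V$ be a function on $M$ and $V_i=V\circ\tau_i$. If $d(K\,dV)=0$ on $M$, then $$ d(K_i\,dV)=0\ \text{ on } M \quad\Longleftrightarrow\quad d(\tilde K_i\,dV_i)=0\ \text{ on } M_i , $$ where, in each equation, the $2$-tensor acts on one-forms as an endomorphism of the cotangent bundle, an index being lowered with $g$ on $M$ and with $g_i$ on $M_i$. -/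

import Mathlib

open Set Topology
open scoped Manifold ContDiff

noncomputable section

namespace PseudoRiem

section Manifold

variable {E : Type*} [NormedAddCommGroup E] [NormedSpace ℝ E]
  {H : Type*} [TopologicalSpace H] (I : ModelWithCorners ℝ E H)
  {M : Type*} [TopologicalSpace M] [ChartedSpace H M]

/-! Throughout, `M` is a manifold without boundary, and "in the chart at `x`" refers to the
preferred chart `extChartAt I x` of `M` at `x`, which maps a neighbourhood of `x` onto an open
subset of the model space `E`. -/

/-- The differential at `p` of the chart at `x`. -/
def chartD (x p : M) : TangentSpace I p →L[ℝ] E :=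
  mfderiv I 𝓘(ℝ, E) (extChartAt I x) p

/-- The differential at `e` of the inverse of the chart at `x`. -/
def chartSymmD (x : M) (e : E) : E →L[ℝ] TangentSpace I ((extChartAt I x).symm e) :=
  mfderiv 𝓘(ℝ, E) I (extChartAt I x).symm e

/-- The components, in the chart at `x`, of a vector field `X`. -/
def coordVec (X : ∀ p : M, TangentSpace I p) (x : M) (e : E) : E :=
  chartD I x ((extChartAt I x).symm e) (X ((extChartAt I x).symm e))

/-- The components, in the chart at `x`, of a one-form `η`. -/
def coordForm (η : ∀ p : M, TangentSpace I p →L[ℝ] ℝ) (x : M) (e : E) : E →L[ℝ] ℝ :=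
  (η ((extChartAt I x).symm e)).comp (chartSymmD I x e)

/-- The components, in the chart at `x`, of a covariant two-tensor `g`. -/
def coordCov (g : ∀ p : M, TangentSpace I p →L[ℝ] TangentSpace I p →L[ℝ] ℝ) (x : M) (e : E) :
    E →L[ℝ] E →L[ℝ] ℝ :=
  (ContinuousLinearMap.precomp ℝ (chartSymmD I x e)).comp
    ((g ((extChartAt I x).symm e)).comp (chartSymmD I x e))

/-- The components, in the chart at `x`, of a contravariant two-tensor `K`. A contravariant
two-tensor at `p` is viewed as a linear map `T*_p M → T_p M`, `α ↦ K(α, ·)`. -/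
def coordContra (K : ∀ p : M, (TangentSpace I p →L[ℝ] ℝ) →L[ℝ] TangentSpace I p) (x : M) (e : E) :
    (E →L[ℝ] ℝ) →L[ℝ] E :=
  (chartD I x ((extChartAt I x).symm e)).comp
    ((K ((extChartAt I x).symm e)).comp
      (ContinuousLinearMap.precomp ℝ (chartD I x ((extChartAt I x).symm e))))

/-- The vector field `X` is smooth on the open set `U`: its components in charts are smooth. -/
def SmoothVecOn (U : Set M) (X : ∀ p : M, TangentSpace I p) : Prop :=
  ∀ x : M, ContDiffOn ℝ ∞ (coordVec I X x)
    ((extChartAt I x).target ∩ (extChartAt I x).symm ⁻¹' U)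

variable (M) in
/-- A smooth pseudo-Riemannian metric (of arbitrary signature) on `M`. -/
structure Metric where
  /-- The bilinear form on each tangent space, which is also the musical map `T_p M → T*_p M`. -/
  val : ∀ p : M, TangentSpace I p →L[ℝ] TangentSpace I p →L[ℝ] ℝ
  symm : ∀ p u v, val p u v = val p v u
  nondegenerate : ∀ p u, (∀ v, val p u v = 0) → u = 0
  smooth : ∀ x : M, ContDiffOn ℝ ∞ (coordCov I val x) (extChartAt I x).target

variable (M) in
/-- The smooth symmetric contravariant two-tensor fields on `M`, i.e. the elements of `S²(M)`. -/
structure SymTensor where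
  /-- The tensor at `p`, viewed as the linear map `α ↦ K(α, ·)` from `T*_p M` to `T_p M`. -/
  val : ∀ p : M, (TangentSpace I p →L[ℝ] ℝ) →L[ℝ] TangentSpace I p
  symm : ∀ (p : M) (α β : TangentSpace I p →L[ℝ] ℝ), β (val p α) = α (val p β)
  smooth : ∀ x : M, ContDiffOn ℝ ∞ (coordContra I val x) (extChartAt I x).target

variable {I}

/-- The contravariant metric `G`, i.e. the inverse of `g`, as a map `T*_p M → T_p M`. -/
def Metric.contra (g : Metric I M) (p : M) : (TangentSpace I p →L[ℝ] ℝ) →L[ℝ] TangentSpace I p :=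
  (g.val p).inverse

variable (I) in
/-- The Schouten bracket `[K, G]` of two symmetric contravariant two-tensors, as the cubic form
`ξ ↦ [K, G](ξ, ξ, ξ) = 2 K^{il} ξ_i ∂_l G^{jk} ξ_j ξ_k - 2 G^{il} ξ_i ∂_l K^{jk} ξ_j ξ_k`
in the chart at `x`, evaluated at `x`. -/
def schouten (K G : ∀ p : M, (TangentSpace I p →L[ℝ] ℝ) →L[ℝ] TangentSpace I p)
    (x : M) (ξ : E →L[ℝ] ℝ) : ℝ :=
  2 * fderiv ℝ (fun e => ξ (coordContra I G x e ξ)) (extChartAt I x x)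
      (coordContra I K x (extChartAt I x x) ξ)
    - 2 * fderiv ℝ (fun e => ξ (coordContra I K x e ξ)) (extChartAt I x x)
      (coordContra I G x (extChartAt I x x) ξ)

/-- `K` is a Killing tensor of `(M, g)`: its Schouten bracket with the metric vanishes. -/
def IsKillingTensor (g : Metric I M) (K : SymTensor I M) : Prop :=
  ∀ (x : M) (ξ : E →L[ℝ] ℝ), schouten I K.val g.contra x ξ = 0

/-- The endomorphism of `T_p M` given by the contravariant two-tensor `K`
(one index being lowered by `g`). -/
def Metric.endo (g : Metric I M) (K : SymTensor I M) (p : M) :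
    Module.End ℝ (TangentSpace I p) :=
  ((K.val p).comp (g.val p) : TangentSpace I p →L[ℝ] TangentSpace I p)

variable (I) in
/-- The differential of the function `V`. -/
def diff (V : M → ℝ) (p : M) : TangentSpace I p →L[ℝ] ℝ :=
  mfderiv I 𝓘(ℝ, ℝ) V p

variable (I) in
/-- The exterior derivative of the one-form `η` at `x`, computed in the chart at `x`. -/
def extD (η : ∀ p : M, TangentSpace I p →L[ℝ] ℝ) (x : M) (u v : TangentSpace I x) : ℝ :=
  fderiv ℝ (coordForm I η x) (extChartAt I x x) (chartD I x x u) (chartD I x x v)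
    - fderiv ℝ (coordForm I η x) (extChartAt I x x) (chartD I x x v) (chartD I x x u)

/-- The equation `d(K dV) = 0`, where the contravariant two-tensor `K` acts on one-forms as an
endomorphism of the cotangent bundle (one index being lowered by `g`). -/
def DKdV (g : Metric I M) (K : ∀ p : M, (TangentSpace I p →L[ℝ] ℝ) →L[ℝ] TangentSpace I p)
    (V : M → ℝ) : Prop :=
  ∀ (x : M) (u v : TangentSpace I x),
    extD I (fun p => g.val p (K p (diff I V p))) x u v = 0

/-- The Christoffel symbols of the second kind of `g` at `x`, in the chart at `x`:
`g(Γ(u, v), w) = (∂_u g(v, w) + ∂_v g(u, w) - ∂_w g(u, v)) / 2`. -/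
def Metric.christoffel (g : Metric I M) (x : M) (u v : E) : E :=
  (coordCov I g.val x (extChartAt I x x)).inverse
    ((1 / 2 : ℝ) • (fderiv ℝ (coordCov I g.val x) (extChartAt I x x) u v
      + fderiv ℝ (coordCov I g.val x) (extChartAt I x x) v u
      - ((fderiv ℝ (coordCov I g.val x) (extChartAt I x x)).flip u).flip v))

/-- The Levi-Civita covariant derivative `∇_X Y` at `x`. -/
def Metric.covDeriv (g : Metric I M) (X Y : ∀ p : M, TangentSpace I p) (x : M) :
    TangentSpace I x :=
  (chartD I x x).inverse
    (fderiv ℝ (coordVec I Y x) (extChartAt I x x) (chartD I x x (X x))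
      + g.christoffel x (chartD I x x (X x)) (chartD I x x (Y x)))

/-- `X` is a smooth section, over the open set `U`, of the distribution `D`. -/
def IsSectionOn (D : ∀ p : M, Submodule ℝ (TangentSpace I p)) (U : Set M)
    (X : ∀ p : M, TangentSpace I p) : Prop :=
  SmoothVecOn I U X ∧ ∀ p ∈ U, X p ∈ D p

/-- The orthogonal complement of the distribution `D`. -/
def Metric.orth (g : Metric I M) (D : ∀ p : M, Submodule ℝ (TangentSpace I p)) (p : M) :
    Submodule ℝ (TangentSpace I p) where
  carrier := {v | ∀ w ∈ D p, g.val p v w = 0}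
  add_mem' := fun {a b} ha hb w hw => by simp [ha w hw, hb w hw]
  zero_mem' := fun w _ => by simp
  smul_mem' := fun c a ha w hw => by simp [ha w hw]

/-- `D` is non-degenerate: `g` restricts to a non-degenerate form on each `D p`. -/
def IsNondegenerate (g : Metric I M) (D : ∀ p : M, Submodule ℝ (TangentSpace I p)) : Prop :=
  ∀ p, D p ⊓ g.orth D p = ⊥

/-- `D` is geodesic: `∇_X Y` is a section of `D` for all (local) sections `X`, `Y` of `D`. -/
def IsGeodesic (g : Metric I M) (D : ∀ p : M, Submodule ℝ (TangentSpace I p)) : Prop :=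
  ∀ (U : Set M) (X Y : ∀ p : M, TangentSpace I p), IsOpen U →
    IsSectionOn D U X → IsSectionOn D U Y → ∀ p ∈ U, g.covDeriv X Y p ∈ D p

/-- `D` is spherical: there is a section `N` of the orthogonal complement of `D` (the mean
curvature normal) such that, for all (local) sections `X`, `Y` of `D`, the normal component of
`∇_X Y` is `g(X, Y) N` (`D` is umbilical) and the normal component of `∇_X N` vanishes. -/
def IsSpherical (g : Metric I M) (D : ∀ p : M, Submodule ℝ (TangentSpace I p)) : Prop :=
  ∃ N : ∀ p : M, TangentSpace I p, IsSectionOn (g.orth D) univ N ∧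
    (∀ (U : Set M) (X Y : ∀ p : M, TangentSpace I p), IsOpen U →
      IsSectionOn D U X → IsSectionOn D U Y → ∀ p ∈ U, ∀ z ∈ g.orth D p,
        g.val p (g.covDeriv X Y p) z = g.val p (X p) (Y p) * g.val p (N p) z) ∧
    (∀ (U : Set M) (X : ∀ p : M, TangentSpace I p), IsOpen U →
      IsSectionOn D U X → ∀ p ∈ U, ∀ z ∈ g.orth D p,
        g.val p (g.covDeriv X N p) z = 0)

/-- `D` is a Killing distribution: it is non-degenerate and spherical, and its orthogonal
complement is geodesic. -/
def IsKillingDistribution (g : Metric I M) (D : ∀ p : M, Submodule ℝ (TangentSpace I p)) :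
    Prop :=
  IsNondegenerate g D ∧ IsSpherical g D ∧ IsGeodesic g (g.orth D)

end Manifold

section Product

variable {ι : Type*} [Fintype ι] [DecidableEq ι]
  {E : ι → Type*} [∀ j, NormedAddCommGroup (E j)] [∀ j, NormedSpace ℝ (E j)]
  {M : ι → Type*} [∀ j, TopologicalSpace (M j)] [∀ j, ChartedSpace (E j) (M j)]

variable (E) in
/-- The model with corners (without boundary) of the product manifold `∏ j, M j`, where `M j` is
modelled on `E j`. -/
abbrev prodModel : ModelWithCorners ℝ (∀ j, E j) (ModelPi E) :=
  ModelWithCorners.pi fun j => 𝓘(ℝ, E j)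

/-- The canonical embedding `τ_i : M i → ∏ j, M j` onto the leaf through `p`. -/
def leafMap (p : ∀ j, M j) (i : ι) : M i → ∀ j, M j := Function.update p i

variable (E) in
/-- The differential of `τ_i : M i → ∏ j, M j` at the point `q` of `M i`. -/
def leafMapD (p : ∀ j, M j) (i : ι) (q : M i) :
    TangentSpace 𝓘(ℝ, E i) q →L[ℝ] TangentSpace (prodModel E) (leafMap p i q) :=
  mfderiv 𝓘(ℝ, E i) (prodModel E) (leafMap p i) q

variable (E) in
/-- The inclusion `T_{p_i} M i → T_p (∏ j, M j)`: the differential at `p i` of the embedding `τ_i`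
onto the leaf through `p` (note that `τ_i (p i) = p`). -/
def factorIncl (p : ∀ j, M j) (i : ι) :
    TangentSpace 𝓘(ℝ, E i) (p i) →L[ℝ] TangentSpace (prodModel E) p :=
  leafMapD E p i (p i)

variable (E) in
/-- The distribution `E_i` of the product net: the tangent spaces of the leaves of `M i`. -/
def productNet (i : ι) (p : ∀ j, M j) : Submodule ℝ (TangentSpace (prodModel E) p) :=
  LinearMap.range (factorIncl E p i : TangentSpace 𝓘(ℝ, E i) (p i) →ₗ[ℝ] _)

/-- The lift to `∏ j, M j` of a contravariant two-tensor on `M i`. -/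
def liftTensor (i : ι) (K : SymTensor 𝓘(ℝ, E i) (M i)) (p : ∀ j, M j) :
    (TangentSpace (prodModel E) p →L[ℝ] ℝ) →L[ℝ] TangentSpace (prodModel E) p :=
  (factorIncl E p i).comp
    ((K.val (p i)).comp (ContinuousLinearMap.precomp ℝ (factorIncl E p i)))

end Product

end PseudoRiem

end

/-!
The Killing equation, compared on sums `u + z` of eigenvectors `u ∈ E_a`, `z ∈ E_b`, gives
`(λ_a - λ_b) ∂_z (g(u, u')) = (∂_z λ_a) g(u, u')` for all `u, u' ∈ E_a`: each eigenspace is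
umbilical, and its eigenvalue governs how the metric varies transversally. Since `E_i^⊥` is
geodesic, `g(z, z')` does not vary along `E_i` for `z, z' ∈ E_j`, `j ≠ i`, so `∂_u λ_j = 0` for
`u ∈ E_i`, and the mixed component of `d(K dV) = 0` becomes
`(λ_i - λ_j) ∂_z ∂_u V = -(∂_z λ_i) ∂_u V`. Hence in `K_i dV` the variations of `g` and of `dV`
in the directions transverse to `M_i` cancel. As the other factors are connected, `K_i dV` is
therefore the pullback from `M_i` of `c K̃_i dV_i`, and `d` commutes with pullbacks.
-/

noncomputable section

namespace PseudoRiem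

lemma isInvertible_of_nondegenerate {E : Type*} [NormedAddCommGroup E] [NormedSpace ℝ E]
    [FiniteDimensional ℝ E] (A : E →L[ℝ] E →L[ℝ] ℝ) (h : ∀ u, (∀ v, A u v = 0) → u = 0) :
    A.IsInvertible := by
  have hinj : Function.Injective (A : E →ₗ[ℝ] (E →L[ℝ] ℝ)) :=
    (injective_iff_map_eq_zero _).2 fun u hu => h u fun v => DFunLike.congr_fun hu v
  have hrank : Module.finrank ℝ E = Module.finrank ℝ (E →L[ℝ] ℝ) := by
    rw [← (LinearMap.toContinuousLinearMap : (E →ₗ[ℝ] ℝ) ≃ₗ[ℝ] _).finrank_eq]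
    exact (Subspace.dual_finrank_eq (K := ℝ) (V := E)).symm
  exact ⟨(LinearEquiv.ofInjectiveOfFinrankEq _ hinj hrank).toContinuousLinearEquiv, rfl⟩

lemma connectedSpace_of_pi {ι : Type*} {M : ι → Type*} [∀ j, TopologicalSpace (M j)]
    [ConnectedSpace (∀ j, M j)] (j : ι) : ConnectedSpace (M j) :=
  have (k : ι) : Nonempty (M k) := ‹ConnectedSpace (∀ j, M j)›.toNonempty.map (· k)
  (Function.surjective_eval j).connectedSpace (continuous_apply j)

lemma dependsOn_of_forall_update_eq {ι : Type*} [Finite ι] [DecidableEq ι] {α : ι → Type*}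
    {β : Type*} {f : (∀ j, α j) → β} {s : Set ι}
    (h : ∀ p, ∀ j ∉ s, ∀ q, f (Function.update p j q) = f p) : DependsOn f s := by
  cases nonempty_fintype ι
  intro p p' hpp'
  have piecewise_eq : ∀ t : Finset ι, f (t.piecewise p' p) = f p := by
    intro t
    induction t using Finset.induction_on with
    | empty => rw [Finset.piecewise_empty]
    | insert j t hj ih =>
      rw [Finset.piecewise_insert, ← ih]
      by_cases hjs : j ∈ s
      · rw [← hpp' j hjs, ← Finset.piecewise_eq_of_notMem t p' p hj, Function.update_eq_self]
      · exact h _ j hjs _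
  rw [← piecewise_eq Finset.univ, Finset.piecewise_univ]

lemma hasFDerivAt_update_single {𝕜 : Type*} [NontriviallyNormedField 𝕜] {ι : Type*}
    [DecidableEq ι] {F : ι → Type*} [∀ j, NormedAddCommGroup (F j)] [∀ j, NormedSpace 𝕜 (F j)]
    (e : ∀ j, F j) (i : ι) (y : F i) :
    HasFDerivAt (Function.update e i) (ContinuousLinearMap.single 𝕜 F i) y :=
  (hasFDerivAt_update e y).congr_fderiv <| ContinuousLinearMap.ext fun v => funext fun k => by
    obtain rfl | hk := eq_or_ne k i
    · simp
    · simp [hk]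

section Charts

variable {E : Type*} [NormedAddCommGroup E] [NormedSpace ℝ E]
  {H : Type*} [TopologicalSpace H] {I : ModelWithCorners ℝ E H}
  {M : Type*} [TopologicalSpace M] [ChartedSpace H M]

lemma hasMFDerivAt_iff_of_boundaryless [I.Boundaryless] {E' H' M' : Type*}
    [NormedAddCommGroup E'] [NormedSpace ℝ E'] [TopologicalSpace H'] {I' : ModelWithCorners ℝ E' H'}
    [TopologicalSpace M'] [ChartedSpace H' M'] {f : M → M'} {x : M} (L : E →L[ℝ] E') :
    HasMFDerivAt I I' f x L ↔ ContinuousAt f x ∧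
      HasFDerivAt (writtenInExtChartAt I I' x f) L (extChartAt I x x) := by
  rw [← hasFDerivWithinAt_univ, ← I.range_eq_univ]
  rfl

lemma differentiableAt_of_contDiffOn_target [I.Boundaryless] {F : Type*} [NormedAddCommGroup F]
    [NormedSpace ℝ F] {f : E → F} {x : M} (hf : ContDiffOn ℝ ∞ f (extChartAt I x).target) :
    DifferentiableAt ℝ f (extChartAt I x x) :=
  (hf.contDiffAt (extChartAt_target_mem_nhds x)).differentiableAt (by simp)

section Differentials

variable [IsManifold I 1 M]

lemma chartD_self (x : M) (v : TangentSpace I x) : chartD I x x v = v :=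
  DFunLike.congr_fun (mfderiv_extChartAt_self (I := I) (x := x)) v

lemma chartD_isInvertible {x p : M} (hp : p ∈ (extChartAt I x).source) :
    (chartD I x p).IsInvertible :=
  isInvertible_mfderiv_extChartAt hp

variable [I.Boundaryless]

lemma chartD_chartSymmD {x : M} {e : E} (he : e ∈ (extChartAt I x).target) (v : E) :
    chartD I x ((extChartAt I x).symm e) (chartSymmD I x e v) = v := by
  have h := mfderiv_extChartAt_comp_mfderivWithin_extChartAt_symm (I := I) he
  rw [I.range_eq_univ, mfderivWithin_univ] at h
  exact DFunLike.congr_fun h v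

lemma chartSymmD_chartD {x : M} {e : E} (he : e ∈ (extChartAt I x).target)
    (w : TangentSpace I ((extChartAt I x).symm e)) :
    chartSymmD I x e (chartD I x ((extChartAt I x).symm e) w) = w := by
  have h := mfderivWithin_extChartAt_symm_comp_mfderiv_extChartAt (I := I) he
  rw [I.range_eq_univ, mfderivWithin_univ] at h
  exact DFunLike.congr_fun h w

lemma chartSymmD_self (x : M) (v : E) : (chartSymmD I x (extChartAt I x x) v : E) = v := by
  have chartD_of_eq : ∀ p : M, p = x → ∀ w : E, (chartD I x p : E →L[ℝ] E) w = w := by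
    rintro p rfl w
    exact chartD_self p w
  exact (chartD_of_eq _ (extChartAt_to_inv x) _).symm.trans
    (chartD_chartSymmD (mem_extChartAt_target (I := I) x) v)

lemma mdifferentiableAt_extChartAt_symm {x : M} {e : E} (he : e ∈ (extChartAt I x).target) :
    MDifferentiableAt 𝓘(ℝ, E) I (extChartAt I x).symm e := by
  have h := mdifferentiableWithinAt_extChartAt_symm (I := I) he
  rwa [I.range_eq_univ, mdifferentiableWithinAt_univ] at h

lemma fderiv_coordChange {x y : M} {e : E} (he : e ∈ (extChartAt I x).target)
    (hy : (extChartAt I x).symm e ∈ (extChartAt I y).source) (w : E) :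
    fderiv ℝ (extChartAt I y ∘ (extChartAt I x).symm) e w =
      chartD I y ((extChartAt I x).symm e) (chartSymmD I x e w) := by
  rw [← mfderiv_eq_fderiv, mfderiv_comp e (I' := I)
    (mdifferentiableAt_extChartAt (by rwa [← extChartAt_source I]))
    (mdifferentiableAt_extChartAt_symm he)]
  rfl

lemma isLocallyConstant_of_hasMFDerivAt_zero {F : Type*} [NormedAddCommGroup F] [NormedSpace ℝ F]
    {f : M → F} (hf : ∀ q, HasMFDerivAt I 𝓘(ℝ, F) f q (0 : E →L[ℝ] F)) : IsLocallyConstant f := by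
  rw [IsLocallyConstant.iff_eventually_eq]
  intro x
  obtain ⟨r, hr, hball⟩ := Metric.isOpen_iff.1 (isOpen_extChartAt_target (I := I) x) _
    (mem_extChartAt_target x)
  have hder : ∀ e ∈ (extChartAt I x).target,
      HasFDerivAt (f ∘ (extChartAt I x).symm) (0 : E →L[ℝ] F) e := by
    intro e he
    have h := (hf _).comp e (mdifferentiableAt_extChartAt_symm he).hasMFDerivAt
    rw [hasMFDerivAt_iff_hasFDerivAt] at h
    exact h.congr_fderiv (ContinuousLinearMap.zero_comp _)
  filter_upwards [(continuousAt_extChartAt (I := I) x).preimage_mem_nhds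
    (Metric.ball_mem_nhds _ hr), extChartAt_source_mem_nhds (I := I) x] with y hy hys
  have h := Metric.isOpen_ball.is_const_of_fderiv_eq_zero (𝕜 := ℝ)
    (convex_ball _ r).isPreconnected
    (fun e he => (hder e (hball he)).differentiableAt.differentiableWithinAt)
    (fun e he => (hder e (hball he)).fderiv) hy (Metric.mem_ball_self hr)
  simpa only [Function.comp_apply, (extChartAt I x).left_inv hys, extChartAt_to_inv] using h

end Differentials

section CoordinateFields

variable (I) in
/-- The coordinate vector field, with constant components `w`, of the chart at `x`. It is
meaningful on the domain of the chart only. -/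
def coordField (x : M) (w : E) (p : M) : TangentSpace I p :=
  (chartD I x p).inverse w

lemma chartD_coordField [IsManifold I 1 M] {x p : M} (hp : p ∈ (extChartAt I x).source) (w : E) :
    chartD I x p (coordField I x w p) = w :=
  (chartD_isInvertible hp).self_apply_inverse w

lemma coordField_self [IsManifold I 1 M] (x : M) (w : E) : coordField I x w x = w :=
  (chartD_self (I := I) x _).symm.trans (chartD_coordField (mem_extChartAt_source x) w)

lemma fderiv_coordVec_coordField [IsManifold I 1 M] [I.Boundaryless] (x : M) (w : E) :
    fderiv ℝ (coordVec I (coordField I x w) x) (extChartAt I x x) = 0 := by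
  have h : coordVec I (coordField I x w) x =ᶠ[𝓝 (extChartAt I x x)] fun _ => w := by
    filter_upwards [extChartAt_target_mem_nhds x] with e he
    exact chartD_coordField ((extChartAt I x).map_target he) w
  rw [h.fderiv_eq, fderiv_const_apply]

variable [I.Boundaryless]

lemma coordField_extChartAt_symm [IsManifold I 1 M] {x : M} {e : E}
    (he : e ∈ (extChartAt I x).target) (w : E) :
    coordField I x w ((extChartAt I x).symm e) = chartSymmD I x e w :=
  (chartD_isInvertible ((extChartAt I x).map_target he)).inverse_apply_eq.2
    (chartD_chartSymmD he w).symm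

lemma coordVec_coordField [IsManifold I 1 M] {x y : M} {e : E}
    (he : e ∈ (extChartAt I y).target) (hx : (extChartAt I y).symm e ∈ (extChartAt I x).source)
    (w : E) :
    coordVec I (coordField I x w) y e = fderiv ℝ (extChartAt I y ∘ (extChartAt I x).symm)
      (extChartAt I x ((extChartAt I y).symm e)) w := by
  have hl := (extChartAt I x).left_inv hx
  have hx' := (extChartAt I x).map_source hx
  rw [fderiv_coordChange hx' (by rw [hl]; exact (extChartAt I y).map_target he),
    ← coordField_extChartAt_symm hx', hl]
  rfl

lemma smoothVecOn_coordField [IsManifold I ∞ M] (x : M) (w : E) :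
    SmoothVecOn I (extChartAt I x).source (coordField I x w) := by
  intro y
  have hopen : IsOpen ((extChartAt I x).symm ≫ extChartAt I y).source := by
    rw [PartialEquiv.trans_source, PartialEquiv.symm_source]
    exact (continuousOn_extChartAt_symm x).isOpen_inter_preimage (isOpen_extChartAt_target x)
      (isOpen_extChartAt_source y)
  have hderiv := ((contDiffOn_ext_coord_change (I := I) (n := ∞) y x).fderiv_of_isOpen hopen
    (m := ∞) (by simp)).clm_apply (contDiffOn_const (c := w))
  refine (hderiv.comp (contDiffOn_ext_coord_change (I := I) (n := ∞) x y) ?_).congr ?_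
  · rintro e ⟨he, hx⟩
    refine ⟨(extChartAt I x).map_source hx, ?_⟩
    have hl : (extChartAt I x).symm (extChartAt I x ((extChartAt I y).symm e)) =
      (extChartAt I y).symm e := (extChartAt I x).left_inv hx
    exact mem_preimage.2 <| mem_of_eq_of_mem hl ((extChartAt I y).map_target he)
  · rintro e ⟨he, hx⟩
    exact coordVec_coordField he hx w

end CoordinateFields

section Metrics

lemma coordForm_comp_chartD [IsManifold I 1 M] [I.Boundaryless]
    (η : ∀ p : M, TangentSpace I p →L[ℝ] ℝ) {x : M} {e : E} (he : e ∈ (extChartAt I x).target) :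
    (coordForm I η x e).comp (chartD I x ((extChartAt I x).symm e)) =
      η ((extChartAt I x).symm e) := by
  ext w
  exact congrArg _ (chartSymmD_chartD he w)

lemma coordCov_comp_chartD [IsManifold I 1 M] [I.Boundaryless]
    (A : ∀ p : M, TangentSpace I p →L[ℝ] TangentSpace I p →L[ℝ] ℝ) {x : M} {e : E}
    (he : e ∈ (extChartAt I x).target) (w : E) :
    (coordCov I A x e w).comp (chartD I x ((extChartAt I x).symm e)) =
      A ((extChartAt I x).symm e) (chartSymmD I x e w) := by
  ext v
  exact congrArg (A _ (chartSymmD I x e w)) (chartSymmD_chartD he v)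

lemma coordCov_self [IsManifold I 1 M] [I.Boundaryless]
    (A : ∀ p : M, TangentSpace I p →L[ℝ] TangentSpace I p →L[ℝ] ℝ) (x : M) (u v : E) :
    coordCov I A x (extChartAt I x x) u v = A x u v := by
  have apply_of_eq : ∀ (p : M) (u' v' : TangentSpace I p), p = x → (u' : E) = u → (v' : E) = v →
      A p u' v' = A x u v := by
    rintro p u' v' rfl hu hv
    exact congrArg₂ (fun s t => A p s t) hu hv
  exact apply_of_eq _ _ _ (extChartAt_to_inv x) (chartSymmD_self x u) (chartSymmD_self x v)

lemma coordForm_contract [IsManifold I 1 M] [I.Boundaryless]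
    (A : ∀ p : M, TangentSpace I p →L[ℝ] TangentSpace I p →L[ℝ] ℝ)
    (K : ∀ p : M, (TangentSpace I p →L[ℝ] ℝ) →L[ℝ] TangentSpace I p)
    (η : ∀ p : M, TangentSpace I p →L[ℝ] ℝ) {x : M} {e : E} (he : e ∈ (extChartAt I x).target) :
    coordForm I (fun p => A p (K p (η p))) x e =
      coordCov I A x e (coordContra I K x e (coordForm I η x e)) := by
  ext v
  change _ = A _ (chartSymmD I x e (chartD I x _ (K _ ((coordForm I η x e).comp
    (chartD I x ((extChartAt I x).symm e)))))) (chartSymmD I x e v)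
  rw [chartSymmD_chartD he, coordForm_comp_chartD η he]
  rfl

lemma SymTensor.coordContra_symm (K : SymTensor I M) (x : M) (e : E) (α β : E →L[ℝ] ℝ) :
    β (coordContra I K.val x e α) = α (coordContra I K.val x e β) :=
  K.symm _ (α.comp (chartD I x ((extChartAt I x).symm e)))
    (β.comp (chartD I x ((extChartAt I x).symm e)))

namespace Metric

lemma coordCov_symm (g : Metric I M) (x : M) (e u v : E) :
    coordCov I g.val x e u v = coordCov I g.val x e v u :=
  g.symm _ _ _

lemma val_contra [FiniteDimensional ℝ E] (g : Metric I M) (p : M)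
    (α : TangentSpace I p →L[ℝ] ℝ) : g.val p (g.contra p α) = α :=
  (isInvertible_of_nondegenerate (E := E) (g.val p) (g.nondegenerate p)).self_apply_inverse α

variable [IsManifold I 1 M] [I.Boundaryless]

lemma coordCov_nondegenerate (g : Metric I M) {x : M} {e : E} (he : e ∈ (extChartAt I x).target)
    (u : E) (h : ∀ v, coordCov I g.val x e u v = 0) : u = 0 := by
  have : chartSymmD I x e u = 0 := by
    refine g.nondegenerate _ _ fun v => ?_
    rw [← coordCov_comp_chartD g.val he]
    exact h _
  rw [← chartD_chartSymmD he u, this, map_zero]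

lemma coordCov_isInvertible [FiniteDimensional ℝ E] (g : Metric I M) {x : M} {e : E}
    (he : e ∈ (extChartAt I x).target) : (coordCov I g.val x e).IsInvertible :=
  isInvertible_of_nondegenerate _ (g.coordCov_nondegenerate he)

lemma coordCov_coordContra_contra [FiniteDimensional ℝ E] (g : Metric I M) {x : M} {e : E}
    (he : e ∈ (extChartAt I x).target) (ξ : E →L[ℝ] ℝ) :
    coordCov I g.val x e (coordContra I g.contra x e ξ) = ξ := by
  ext v
  change g.val _ (chartSymmD I x e (chartD I x _ (g.contra _ (ξ.comp _)))) (chartSymmD I x e v) = _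
  rw [chartSymmD_chartD he, g.val_contra]
  exact congrArg ξ (chartD_chartSymmD he v)

lemma coordContra_contra [FiniteDimensional ℝ E] (g : Metric I M) {x : M} {e : E}
    (he : e ∈ (extChartAt I x).target) (ξ : E →L[ℝ] ℝ) :
    coordContra I g.contra x e ξ = (coordCov I g.val x e).inverse ξ := by
  rw [eq_comm, (g.coordCov_isInvertible he).inverse_apply_eq, g.coordCov_coordContra_contra he]

end Metric

/-- The components at `x` of the metric, in the chart at `x`. -/
def Metric.coordAt (g : Metric I M) (x : M) : E →L[ℝ] E →L[ℝ] ℝ :=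
  coordCov I g.val x (extChartAt I x x)

/-- The partial derivatives at `x` of the components of the metric in the chart at `x`; the first
argument is the direction of differentiation. -/
def Metric.coordDeriv (g : Metric I M) (x : M) : E →L[ℝ] E →L[ℝ] E →L[ℝ] ℝ :=
  fderiv ℝ (coordCov I g.val x) (extChartAt I x x)

/-- The components, in the chart at `x`, of the endomorphism field `g.endo K`. -/
def Metric.coordEndo (g : Metric I M) (K : SymTensor I M) (x : M) (e : E) : E →L[ℝ] E :=
  (coordContra I K.val x e).comp (coordCov I g.val x e)

/-- The components at `x` of the endomorphism field `g.endo K`, in the chart at `x`. -/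
def Metric.endoAt (g : Metric I M) (K : SymTensor I M) (x : M) : E →L[ℝ] E :=
  g.coordEndo K x (extChartAt I x x)

/-- The partial derivatives at `x` of the components of the endomorphism field `g.endo K` in the
chart at `x`; the first argument is the direction of differentiation. -/
def Metric.endoDeriv (g : Metric I M) (K : SymTensor I M) (x : M) : E →L[ℝ] E →L[ℝ] E :=
  fderiv ℝ (g.coordEndo K x) (extChartAt I x x)

namespace Metric

lemma coordAt_symm (g : Metric I M) (x : M) (u v : E) : g.coordAt x u v = g.coordAt x v u :=
  g.coordCov_symm x _ u v

lemma coordAt_endoAt_comm (g : Metric I M) (K : SymTensor I M) (x : M) (u v : E) :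
    g.coordAt x u (g.endoAt K x v) = g.coordAt x v (g.endoAt K x u) :=
  K.coordContra_symm x _ _ _

lemma coordForm_contract_apply [IsManifold I 1 M] [I.Boundaryless] (g : Metric I M)
    (K : SymTensor I M) (η : ∀ p : M, TangentSpace I p →L[ℝ] ℝ) {x : M} {e : E}
    (he : e ∈ (extChartAt I x).target) (w : E) :
    coordForm I (fun p => g.val p (K.val p (η p))) x e w =
      coordForm I η x e (g.coordEndo K x e w) := by
  rw [coordForm_contract g.val K.val η he, g.coordCov_symm, K.coordContra_symm]
  rfl

lemma coordEndo_apply [IsManifold I 1 M] [I.Boundaryless] (g : Metric I M) (K : SymTensor I M)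
    {x : M} {e : E} (he : e ∈ (extChartAt I x).target) (w : E) :
    g.coordEndo K x e w =
      chartD I x _ (g.endo K ((extChartAt I x).symm e) (chartSymmD I x e w)) := by
  change chartD I x _ (K.val _ ((coordCov I g.val x e w).comp _)) = _
  rw [coordCov_comp_chartD g.val he]
  rfl

lemma contDiffOn_coordEndo (g : Metric I M) (K : SymTensor I M) (x : M) :
    ContDiffOn ℝ ∞ (g.coordEndo K x) (extChartAt I x).target :=
  (K.smooth x).clm_comp (g.smooth x)

variable [I.Boundaryless]

lemma hasFDerivAt_coordCov (g : Metric I M) (x : M) :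
    HasFDerivAt (coordCov I g.val x) (g.coordDeriv x) (extChartAt I x x) :=
  (differentiableAt_of_contDiffOn_target (g.smooth x)).hasFDerivAt

lemma hasFDerivAt_coordCov_apply (g : Metric I M) (x : M) (u v : E) :
    HasFDerivAt (fun e => coordCov I g.val x e u v) (((g.coordDeriv x).flip u).flip v)
      (extChartAt I x x) := by
  have h := ((g.hasFDerivAt_coordCov x).clm_apply (hasFDerivAt_const u _)).clm_apply
    (hasFDerivAt_const v _)
  exact h.congr_fderiv (by ext; simp)

lemma coordDeriv_symm (g : Metric I M) (x : M) (Y u v : E) :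
    g.coordDeriv x Y u v = g.coordDeriv x Y v u :=
  DFunLike.congr_fun ((g.hasFDerivAt_coordCov_apply x u v).unique <|
    (g.hasFDerivAt_coordCov_apply x v u).congr_of_eventuallyEq <|
      .of_forall fun _ => g.coordCov_symm _ _ _ _) Y

lemma hasFDerivAt_coordEndo (g : Metric I M) (K : SymTensor I M) (x : M) :
    HasFDerivAt (g.coordEndo K x) (g.endoDeriv K x) (extChartAt I x x) :=
  (differentiableAt_of_contDiffOn_target (g.contDiffOn_coordEndo K x)).hasFDerivAt

variable [IsManifold I 1 M] [FiniteDimensional ℝ E]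

lemma val_covDeriv_coordField (g : Metric I M) (x : M) (u v w : E) :
    g.val x (g.covDeriv (coordField I x u) (coordField I x v) x) (coordField I x w x) =
      (1 / 2 : ℝ) * (g.coordDeriv x u v w + g.coordDeriv x v u w - g.coordDeriv x w u v) := by
  have hx := mem_extChartAt_source (I := I) x
  have hcov : g.covDeriv (coordField I x u) (coordField I x v) x = g.christoffel x u v := by
    refine (chartD_self (I := I) x _).symm.trans ?_
    rw [Metric.covDeriv, (chartD_isInvertible hx).self_apply_inverse, chartD_coordField hx,
      chartD_coordField hx, fderiv_coordVec_coordField, zero_apply, zero_add]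
  rw [hcov, coordField_self]
  refine (coordCov_self g.val x _ _).symm.trans ?_
  rw [Metric.christoffel, (g.coordCov_isInvertible (mem_extChartAt_target x)).self_apply_inverse]
  rfl

end Metric

end Metrics

section KillingEquation

variable [IsManifold I 1 M] [I.Boundaryless] [FiniteDimensional ℝ E]

namespace Metric

lemma coordContra_contra_coordAt (g : Metric I M) (x : M) (X : E) :
    coordContra I g.contra x (extChartAt I x x) (g.coordAt x X) = X := by
  have he := mem_extChartAt_target (I := I) x
  rw [g.coordContra_contra he]
  exact (g.coordCov_isInvertible he).inverse_apply_self X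

lemma hasFDerivAt_coordContra_contra (g : Metric I M) (x : M) (ξ : E →L[ℝ] ℝ) :
    HasFDerivAt (fun e => coordContra I g.contra x e ξ)
      (fderiv ℝ (fun e => coordContra I g.contra x e ξ) (extChartAt I x x))
      (extChartAt I x x) := by
  have : CompleteSpace E := FiniteDimensional.complete ℝ E
  have hev : (fun e => coordContra I g.contra x e ξ) =ᶠ[𝓝 (extChartAt I x x)]
      fun e => (coordCov I g.val x e).inverse ξ := by
    filter_upwards [extChartAt_target_mem_nhds x] with e he
    exact g.coordContra_contra he ξ
  obtain ⟨A₀, hA₀⟩ := g.coordCov_isInvertible (mem_extChartAt_target x)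
  have hinv : ContDiffAt ℝ ∞ ContinuousLinearMap.inverse
      (coordCov I g.val x (extChartAt I x x)) := hA₀ ▸ contDiffAt_map_inverse A₀
  exact ((((hinv.differentiableAt (by simp)).comp _
    (g.hasFDerivAt_coordCov x).differentiableAt).clm_apply
      (differentiableAt_const ξ)).congr_of_eventuallyEq hev).hasFDerivAt

/-- Differentiate `g (G ξ) = ξ`. -/
lemma coordAt_fderiv_coordContra_contra (g : Metric I M) (x : M) (X Y : E) :
    g.coordAt x (fderiv ℝ (fun e => coordContra I g.contra x e (g.coordAt x X))
      (extChartAt I x x) Y) = -g.coordDeriv x Y X := by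
  have hev : (fun e => coordCov I g.val x e (coordContra I g.contra x e (g.coordAt x X)))
      =ᶠ[𝓝 (extChartAt I x x)] fun _ => g.coordAt x X := by
    filter_upwards [extChartAt_target_mem_nhds x] with e he
    exact g.coordCov_coordContra_contra he _
  have hprod := (g.hasFDerivAt_coordCov x).clm_apply
    (g.hasFDerivAt_coordContra_contra x (g.coordAt x X))
  have h := DFunLike.congr_fun
    ((hprod.congr_of_eventuallyEq hev.symm).unique (hasFDerivAt_const _ _)) Y
  rw [g.coordContra_contra_coordAt] at h
  exact eq_neg_of_add_eq_zero_left h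

lemma fderiv_coordContra_contra_apply_self (g : Metric I M) (x : M) (X Y : E) :
    fderiv ℝ (fun e => g.coordAt x X (coordContra I g.contra x e (g.coordAt x X)))
      (extChartAt I x x) Y = -g.coordDeriv x Y X X := by
  have h := (g.coordAt x X).hasFDerivAt.comp _
    (g.hasFDerivAt_coordContra_contra x (g.coordAt x X))
  refine (DFunLike.congr_fun h.fderiv Y).trans ?_
  rw [ContinuousLinearMap.comp_apply, g.coordAt_symm, coordAt_fderiv_coordContra_contra, neg_apply]

/-- Write `K ξ = D (G ξ)`, with `D` the endomorphism given by `K`, and differentiate. -/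
lemma fderiv_coordContra_apply_self (g : Metric I M) (K : SymTensor I M) (x : M) (X Y : E) :
    fderiv ℝ (fun e => g.coordAt x X (coordContra I K.val x e (g.coordAt x X)))
      (extChartAt I x x) Y =
    g.coordAt x X (g.endoDeriv K x Y X) - g.coordDeriv x Y X (g.endoAt K x X) := by
  have hev : (fun e => g.coordAt x X (coordContra I K.val x e (g.coordAt x X)))
      =ᶠ[𝓝 (extChartAt I x x)] fun e =>
        g.coordAt x X (g.coordEndo K x e (coordContra I g.contra x e (g.coordAt x X))) := by
    filter_upwards [extChartAt_target_mem_nhds x] with e he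
    exact congrArg (fun ξ => g.coordAt x X (coordContra I K.val x e ξ))
      (g.coordCov_coordContra_contra he _).symm
  have h := (g.coordAt x X).hasFDerivAt.comp _ ((g.hasFDerivAt_coordEndo K x).clm_apply
    (g.hasFDerivAt_coordContra_contra x (g.coordAt x X)))
  rw [hev.fderiv_eq]
  refine (DFunLike.congr_fun h.fderiv Y).trans ?_
  change g.coordAt x X (g.endoAt K x (fderiv ℝ (fun e => coordContra I g.contra x e
    (g.coordAt x X)) (extChartAt I x x) Y) + g.endoDeriv K x Y _) = _
  rw [map_add, g.coordAt_endoAt_comm, coordAt_fderiv_coordContra_contra, neg_apply,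
    coordContra_contra_coordAt]
  ring

end Metric

/-- The Killing equation `∇_X K (X, X) = 0` without Christoffel symbols. -/
lemma IsKillingTensor.coord_eq {g : Metric I M} {K : SymTensor I M} (hK : IsKillingTensor g K)
    (x : M) (X : E) :
    g.coordDeriv x (g.endoAt K x X) X X + g.coordAt x X (g.endoDeriv K x X X) =
      g.coordDeriv x X X (g.endoAt K x X) := by
  have h := hK x (g.coordAt x X)
  change 2 * fderiv ℝ (fun e => g.coordAt x X (coordContra I g.contra x e _)) _ (g.endoAt K x X)
    - 2 * fderiv ℝ (fun e => g.coordAt x X (coordContra I K.val x e _)) _ _ = 0 at h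
  rw [g.coordContra_contra_coordAt, g.fderiv_coordContra_contra_apply_self,
    g.fderiv_coordContra_apply_self] at h
  linarith

end KillingEquation

section Functions

lemma extD_eq [IsManifold I 1 M] (η : ∀ p : M, TangentSpace I p →L[ℝ] ℝ) (x : M) (u v : E) :
    extD I η x u v = fderiv ℝ (coordForm I η x) (extChartAt I x x) u v
      - fderiv ℝ (coordForm I η x) (extChartAt I x x) v u :=
  congrArg₂ (fun s t => fderiv ℝ (coordForm I η x) (extChartAt I x x) s t
    - fderiv ℝ (coordForm I η x) (extChartAt I x x) t s) (chartD_self x u) (chartD_self x v)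

variable (I) in
/-- The partial derivatives at `x` of the function `V`, in the chart at `x`. -/
def coordDiff (V : M → ℝ) (x : M) : E →L[ℝ] ℝ :=
  fderiv ℝ (V ∘ (extChartAt I x).symm) (extChartAt I x x)

variable (I) in
/-- The second partial derivatives at `x` of the function `V`, in the chart at `x`. -/
def coordHess (V : M → ℝ) (x : M) : E →L[ℝ] E →L[ℝ] ℝ :=
  fderiv ℝ (fderiv ℝ (V ∘ (extChartAt I x).symm)) (extChartAt I x x)

/-- The one-form `K dV`, the contravariant two-tensor `K` acting as an endomorphism of the cotangent
bundle, as in `DKdV`. -/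
def Metric.kdV (g : Metric I M)
    (K : ∀ p : M, (TangentSpace I p →L[ℝ] ℝ) →L[ℝ] TangentSpace I p) (V : M → ℝ) (p : M) :
    TangentSpace I p →L[ℝ] ℝ :=
  g.val p (K p (diff I V p))

variable [IsManifold I ∞ M] {V : M → ℝ} (hV : ContMDiff I 𝓘(ℝ, ℝ) ∞ V)
include hV

lemma contDiffOn_comp_extChartAt_symm (x : M) :
    ContDiffOn ℝ ∞ (V ∘ (extChartAt I x).symm) (extChartAt I x).target :=
  contMDiffOn_iff_contDiffOn.1 (hV.comp_contMDiffOn (contMDiffOn_extChartAt_symm x))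

variable [I.Boundaryless]

lemma contDiffOn_fderiv_comp_extChartAt_symm (x : M) :
    ContDiffOn ℝ ∞ (fderiv ℝ (V ∘ (extChartAt I x).symm)) (extChartAt I x).target :=
  (contDiffOn_comp_extChartAt_symm hV x).fderiv_of_isOpen (isOpen_extChartAt_target x) (by simp)

lemma coordForm_diff {x : M} {e : E} (he : e ∈ (extChartAt I x).target) :
    coordForm I (diff I V) x e = fderiv ℝ (V ∘ (extChartAt I x).symm) e := by
  rw [← mfderiv_eq_fderiv, mfderiv_comp e (I' := I) (hV.mdifferentiableAt (by simp))
    (mdifferentiableAt_extChartAt_symm he)]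
  rfl

lemma hasFDerivAt_comp_extChartAt_symm (x : M) :
    HasFDerivAt (V ∘ (extChartAt I x).symm) (coordDiff I V x) (extChartAt I x x) :=
  (differentiableAt_of_contDiffOn_target (contDiffOn_comp_extChartAt_symm hV x)).hasFDerivAt

lemma hasFDerivAt_fderiv_comp_extChartAt_symm (x : M) :
    HasFDerivAt (fderiv ℝ (V ∘ (extChartAt I x).symm)) (coordHess I V x) (extChartAt I x x) :=
  (differentiableAt_of_contDiffOn_target (contDiffOn_fderiv_comp_extChartAt_symm hV x)).hasFDerivAt

lemma coordHess_symm (x : M) (u v : E) : coordHess I V x u v = coordHess I V x v u :=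
  (((contDiffOn_comp_extChartAt_symm hV x).contDiffAt
    (extChartAt_target_mem_nhds x)).isSymmSndFDerivAt (by
      rw [minSmoothness_of_isRCLikeNormedField]
      exact WithTop.coe_le_coe.2 (le_top : (2 : ℕ∞) ≤ ⊤))).eq u v

lemma coordForm_kdV (g : Metric I M)
    (K : ∀ p : M, (TangentSpace I p →L[ℝ] ℝ) →L[ℝ] TangentSpace I p) {x : M} {e : E}
    (he : e ∈ (extChartAt I x).target) :
    coordForm I (g.kdV K V) x e =
      coordCov I g.val x e (coordContra I K x e (fderiv ℝ (V ∘ (extChartAt I x).symm) e)) := by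
  rw [← coordForm_diff hV he]
  exact coordForm_contract g.val K _ he

lemma differentiableAt_coordForm_kdV (g : Metric I M) (K : SymTensor I M) (x : M) :
    DifferentiableAt ℝ (coordForm I (g.kdV K.val V) x) (extChartAt I x x) :=
  differentiableAt_of_contDiffOn_target <|
    ((g.smooth x).clm_apply ((K.smooth x).clm_apply
      (contDiffOn_fderiv_comp_extChartAt_symm hV x))).congr fun _ he => coordForm_kdV hV g K.val he

lemma fderiv_coordForm_kdV (g : Metric I M) (K : SymTensor I M) (x : M) (u v : E) :
    fderiv ℝ (coordForm I (g.kdV K.val V) x) (extChartAt I x x) u v =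
      coordHess I V x u (g.endoAt K x v) + coordDiff I V x (g.endoDeriv K x u v) := by
  have hev : (fun e => coordForm I (g.kdV K.val V) x e v) =ᶠ[𝓝 (extChartAt I x x)]
      fun e => fderiv ℝ (V ∘ (extChartAt I x).symm) e (g.coordEndo K x e v) := by
    filter_upwards [extChartAt_target_mem_nhds x] with e he
    rw [← coordForm_diff hV he]
    exact g.coordForm_contract_apply K _ he v
  have hleft := (differentiableAt_coordForm_kdV hV g K x).hasFDerivAt.clm_apply
    (hasFDerivAt_const v _)
  have hright := (hasFDerivAt_fderiv_comp_extChartAt_symm hV x).clm_apply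
    ((g.hasFDerivAt_coordEndo K x).clm_apply (hasFDerivAt_const v _))
  have h := DFunLike.congr_fun ((hleft.congr_of_eventuallyEq hev.symm).unique hright) u
  simp only [add_apply, ContinuousLinearMap.comp_apply, ContinuousLinearMap.flip_apply,
    zero_apply, map_zero, zero_add] at h
  exact h.trans (add_comm _ _)

lemma DKdV.coord_eq {g : Metric I M} {K : SymTensor I M} (h : DKdV g K.val V) (x : M) (u v : E) :
    coordHess I V x u (g.endoAt K x v) + coordDiff I V x (g.endoDeriv K x u v) =
      coordHess I V x v (g.endoAt K x u) + coordDiff I V x (g.endoDeriv K x v u) := by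
  rw [← fderiv_coordForm_kdV hV, ← fderiv_coordForm_kdV hV]
  exact sub_eq_zero.1 ((extD_eq _ x u v).symm.trans (h x u v))

end Functions

end Charts

section Pi

section Models

variable {ι : Type*} [Fintype ι] {𝕜 : Type*} [NontriviallyNormedField 𝕜]
  {E : ι → Type*} [∀ j, NormedAddCommGroup (E j)] [∀ j, NormedSpace 𝕜 (E j)]
  {H : ι → Type*} [∀ j, TopologicalSpace (H j)] (I : ∀ j, ModelWithCorners 𝕜 (E j) (H j))

instance boundaryless_pi [∀ j, (I j).Boundaryless] : (ModelWithCorners.pi I).Boundaryless where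
  range_eq_univ := by
    refine (range_piMap fun j => I j).trans ?_
    simp only [ModelWithCorners.range_eq_univ, pi_univ]

instance isManifold_pi {n : WithTop ℕ∞} {M : ι → Type*} [∀ j, TopologicalSpace (M j)]
    [∀ j, ChartedSpace (H j) (M j)] [∀ j, IsManifold (I j) n (M j)] :
    IsManifold (ModelWithCorners.pi I) n (∀ j, M j) := by
  refine isManifold_of_contDiffOn _ _ _ ?_
  rintro _ _ ⟨e, he, rfl⟩ ⟨e', he', rfl⟩
  rw [contDiffOn_pi]
  intro j
  have h := (contDiffGroupoid n (I j)).compatible (he j (mem_univ j)) (he' j (mem_univ j))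
  rw [contDiffGroupoid, mem_groupoid_of_pregroupoid] at h
  have hj : ContDiffOn 𝕜 n (I j ∘ ((e j).symm ≫ₕ e' j) ∘ (I j).symm)
    ((I j).symm ⁻¹' ((e j).symm ≫ₕ e' j).source ∩ range (I j)) := h.1
  refine hj.comp (ContinuousLinearMap.proj (R := 𝕜) (φ := E) j).contDiff.contDiffOn ?_
  rintro v ⟨hv, w, rfl⟩
  exact ⟨⟨hv.1 j (mem_univ j), hv.2 j (mem_univ j)⟩, mem_range_self (w j)⟩

end Models

variable {ι : Type*} [Fintype ι]
  {E : ι → Type*} [∀ j, NormedAddCommGroup (E j)] [∀ j, NormedSpace ℝ (E j)]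
  {M : ι → Type*} [∀ j, TopologicalSpace (M j)] [∀ j, ChartedSpace (E j) (M j)]

lemma mem_extChartAt_pi_source {x p : ∀ j, M j} :
    p ∈ (extChartAt (prodModel E) x).source ↔
      ∀ j, p j ∈ (extChartAt 𝓘(ℝ, E j) (x j)).source := by
  simp only [extChartAt_source]
  exact mem_univ_pi

lemma mem_extChartAt_pi_target {x : ∀ j, M j} {e : ∀ j, E j} :
    e ∈ (extChartAt (prodModel E) x).target ↔
      ∀ j, e j ∈ (extChartAt 𝓘(ℝ, E j) (x j)).target := by
  simp only [extChartAt_target, ModelWithCorners.range_eq_univ, inter_univ]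
  exact mem_univ_pi

section Leaf

variable [DecidableEq ι]

lemma extChartAt_pi_symm_update (p : ∀ j, M j) (j : ι) (e : E j) :
    (extChartAt (prodModel E) p).symm (Function.update (extChartAt (prodModel E) p p) j e) =
      leafMap p j ((extChartAt 𝓘(ℝ, E j) (p j)).symm e) := by
  funext k
  change (extChartAt 𝓘(ℝ, E k) (p k)).symm (Function.update _ j e k) = Function.update p j _ k
  obtain rfl | hk := eq_or_ne k j
  · rw [Function.update_self, Function.update_self]
  · rw [Function.update_of_ne hk, Function.update_of_ne hk]
    exact extChartAt_to_inv (I := 𝓘(ℝ, E k)) (p k)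

lemma writtenInExtChartAt_leafMap (p : ∀ j, M j) (i : ι) (q : M i) :
    writtenInExtChartAt 𝓘(ℝ, E i) (prodModel E) q (leafMap p i)
      =ᶠ[𝓝 (extChartAt 𝓘(ℝ, E i) q q)] Function.update (extChartAt (prodModel E) p p) i := by
  filter_upwards [extChartAt_target_mem_nhds (I := 𝓘(ℝ, E i)) q] with e he
  funext j
  change extChartAt 𝓘(ℝ, E j) (Function.update p i q j)
    (Function.update p i ((extChartAt 𝓘(ℝ, E i) q).symm e) j) = _
  obtain rfl | hj := eq_or_ne j i
  · rw [Function.update_self, Function.update_self, Function.update_self,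
      PartialEquiv.right_inv _ he]
  · rw [Function.update_of_ne hj, Function.update_of_ne hj, Function.update_of_ne hj]
    rfl

lemma hasMFDerivAt_leafMap (p : ∀ j, M j) (i : ι) (q : M i) :
    HasMFDerivAt 𝓘(ℝ, E i) (prodModel E) (leafMap p i) q (ContinuousLinearMap.single ℝ E i) :=
  (hasMFDerivAt_iff_of_boundaryless _).2
    ⟨(continuous_const.update i continuous_id).continuousAt,
      (hasFDerivAt_update_single _ i _).congr_of_eventuallyEq (writtenInExtChartAt_leafMap p i q)⟩

lemma contMDiff_leafMap (p : ∀ j, M j) (i : ι) :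
    ContMDiff 𝓘(ℝ, E i) (prodModel E) ∞ (leafMap p i) := by
  intro q
  refine contMDiffAt_iff.2 ⟨(continuous_const.update i continuous_id).continuousAt, ?_⟩
  rw [ModelWithCorners.range_eq_univ, contDiffWithinAt_univ]
  exact (contDiff_update ∞ _ i).contDiffAt.congr_of_eventuallyEq
    (writtenInExtChartAt_leafMap p i q)

lemma leafMapD_eq_single (p : ∀ j, M j) (i : ι) (q : M i) :
    leafMapD E p i q = (ContinuousLinearMap.single ℝ E i : E i →L[ℝ] ∀ j, E j) :=
  (hasMFDerivAt_leafMap p i q).mfderiv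

lemma factorIncl_eq_single (p : ∀ j, M j) (i : ι) :
    factorIncl E p i = (ContinuousLinearMap.single ℝ E i : E i →L[ℝ] ∀ j, E j) :=
  leafMapD_eq_single p i (p i)

lemma mem_productNet {i : ι} {p : ∀ j, M j} {w : TangentSpace (prodModel E) p} :
    w ∈ productNet E i p ↔ ∃ v : E i, (Pi.single i v : ∀ j, E j) = w := by
  rw [productNet, factorIncl_eq_single]
  rfl

lemma single_mem_productNet (i : ι) (p : ∀ j, M j) (v : E i) :
    (Pi.single i v : ∀ j, E j) ∈ (productNet E i p : Submodule ℝ (∀ j, E j)) :=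
  mem_productNet.2 ⟨v, rfl⟩

end Leaf

variable [∀ j, IsManifold 𝓘(ℝ, E j) 1 (M j)]

lemma chartD_pi_apply {x p : ∀ j, M j} (hp : p ∈ (extChartAt (prodModel E) x).source)
    (w : ∀ j, E j) (j : ι) :
    (chartD (prodModel E) x p w : ∀ j, E j) j = chartD 𝓘(ℝ, E j) (x j) (p j) (w j) := by
  have hfactor : ∀ j, HasMFDerivAt 𝓘(ℝ, E j) 𝓘(ℝ, E j) (extChartAt 𝓘(ℝ, E j) (x j)) (p j)
      (chartD 𝓘(ℝ, E j) (x j) (p j)) := fun j =>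
    (mdifferentiableAt_extChartAt (by
      rw [← extChartAt_source 𝓘(ℝ, E j)]; exact mem_extChartAt_pi_source.1 hp j)).hasMFDerivAt
  have hprod : HasMFDerivAt (prodModel E) 𝓘(ℝ, ∀ j, E j) (extChartAt (prodModel E) x) p
      (ContinuousLinearMap.piMap fun j => (chartD 𝓘(ℝ, E j) (x j) (p j) : E j →L[ℝ] E j)) := by
    refine (hasMFDerivAt_iff_of_boundaryless _).2 ⟨continuousAt_extChartAt' hp, ?_⟩
    exact hasFDerivAt_pi.2 fun j => HasFDerivAt.comp (extChartAt (prodModel E) p p)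
      (f := fun e : ∀ j, E j => e j) ((hasMFDerivAt_iff_of_boundaryless _).1 (hfactor j)).2
      (ContinuousLinearMap.proj (R := ℝ) (φ := E) j).hasFDerivAt
  exact congrFun (DFunLike.congr_fun hprod.mfderiv w) j

lemma chartSymmD_pi_apply {x : ∀ j, M j} {e : ∀ j, E j}
    (he : e ∈ (extChartAt (prodModel E) x).target) (w : ∀ j, E j) (j : ι) :
    (chartSymmD (prodModel E) x e w : ∀ j, E j) j = chartSymmD 𝓘(ℝ, E j) (x j) (e j) (w j) := by
  have hp := (extChartAt (prodModel E) x).map_target he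
  have h := (chartD_pi_apply hp (chartSymmD (prodModel E) x e w) j).symm.trans
    (congrFun (chartD_chartSymmD he w) j)
  exact (chartSymmD_chartD (mem_extChartAt_pi_target.1 he j) _).symm.trans (congrArg _ h)

variable [DecidableEq ι]

lemma chartD_single {x p : ∀ j, M j} (hp : p ∈ (extChartAt (prodModel E) x).source) (i : ι)
    (v : E i) :
    chartD (prodModel E) x p (Pi.single i v : ∀ j, E j) =
      (Pi.single i (chartD 𝓘(ℝ, E i) (x i) (p i) v) : ∀ j, E j) :=
  funext fun j => (chartD_pi_apply hp _ j).trans <|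
    Pi.apply_single (fun k => (chartD 𝓘(ℝ, E k) (x k) (p k) : E k →L[ℝ] E k))
      (fun _ => map_zero _) i v j

lemma chartSymmD_single {x : ∀ j, M j} {e : ∀ j, E j}
    (he : e ∈ (extChartAt (prodModel E) x).target) (i : ι) (v : E i) :
    chartSymmD (prodModel E) x e (Pi.single i v : ∀ j, E j) =
      (Pi.single i (chartSymmD 𝓘(ℝ, E i) (x i) (e i) v : E i) : ∀ j, E j) :=
  funext fun j => (chartSymmD_pi_apply he _ j).trans <|
    Pi.apply_single (fun k => (chartSymmD 𝓘(ℝ, E k) (x k) (e k) : E k →L[ℝ] E k))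
      (fun _ => map_zero _) i v j

lemma chartSymmD_single_mem {x : ∀ j, M j} {e : ∀ j, E j}
    (he : e ∈ (extChartAt (prodModel E) x).target) (i : ι) (v : E i) :
    chartSymmD (prodModel E) x e (Pi.single i v : ∀ j, E j) ∈
      productNet E i ((extChartAt (prodModel E) x).symm e) :=
  mem_productNet.2 ⟨_, (chartSymmD_single he i v).symm⟩

lemma coordField_single_mem {x p : ∀ j, M j} (hp : p ∈ (extChartAt (prodModel E) x).source)
    (i : ι) (v : E i) :
    coordField (prodModel E) x (Pi.single i v : ∀ j, E j) p ∈ productNet E i p := by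
  obtain ⟨e, he, rfl⟩ : ∃ e ∈ (extChartAt (prodModel E) x).target,
      (extChartAt (prodModel E) x).symm e = p :=
    ⟨_, (extChartAt _ x).map_source hp, (extChartAt _ x).left_inv hp⟩
  rw [coordField_extChartAt_symm he]
  exact chartSymmD_single_mem he i v

lemma coordContra_liftTensor (i : ι) (Ki : SymTensor 𝓘(ℝ, E i) (M i)) {x : ∀ j, M j}
    {e : ∀ j, E j} (he : e ∈ (extChartAt (prodModel E) x).target) (α : (∀ j, E j) →L[ℝ] ℝ) :
    coordContra (prodModel E) (liftTensor i Ki) x e α =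
      ContinuousLinearMap.single ℝ E i (coordContra 𝓘(ℝ, E i) Ki.val (x i) (e i)
        (α.comp (ContinuousLinearMap.single ℝ E i))) := by
  have hincl (v : E i) : chartD (prodModel E) x ((extChartAt (prodModel E) x).symm e)
      (factorIncl E ((extChartAt (prodModel E) x).symm e) i v) =
        (Pi.single i (chartD 𝓘(ℝ, E i) (x i) ((extChartAt (prodModel E) x).symm e i) v) :
          ∀ j, E j) := by
    rw [factorIncl_eq_single]
    exact chartD_single ((extChartAt (prodModel E) x).map_target he) i v
  refine (hincl _).trans (congrArg (fun β => Pi.single (M := E) i (chartD 𝓘(ℝ, E i) (x i)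
    ((extChartAt (prodModel E) x).symm e i) (Ki.val _ β))) ?_)
  ext v
  exact congrArg α (hincl v)

/-- The lift of a symmetric contravariant two-tensor from the factor `M i` to the product, bundled
as a symmetric tensor field. -/
def SymTensor.lift (i : ι) (Ki : SymTensor 𝓘(ℝ, E i) (M i)) :
    SymTensor (prodModel E) (∀ j, M j) where
  val := liftTensor i Ki
  symm p α β := Ki.symm (p i) (α.comp (factorIncl E p i)) (β.comp (factorIncl E p i))
  smooth x := by
    have hfactor : ContDiffOn ℝ ∞ (fun e : ∀ j, E j => coordContra 𝓘(ℝ, E i) Ki.val (x i) (e i))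
        (extChartAt (prodModel E) x).target :=
      (Ki.smooth (x i)).comp (ContinuousLinearMap.proj (R := ℝ) (φ := E) i).contDiff.contDiffOn
        fun _ he => mem_extChartAt_pi_target.1 he i
    refine (contDiffOn_const (c := ContinuousLinearMap.single ℝ E i)).clm_comp (hfactor.clm_comp
      (contDiffOn_const (c := ContinuousLinearMap.precomp ℝ (ContinuousLinearMap.single ℝ E i))))
      |>.congr fun e he => ?_
    ext1 α
    exact coordContra_liftTensor i Ki he α

namespace Metric

lemma coordEndo_lift (g : Metric (prodModel E) (∀ j, M j)) (i : ι)
    (Ki : SymTensor 𝓘(ℝ, E i) (M i)) {x : ∀ j, M j} {e : ∀ j, E j}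
    (he : e ∈ (extChartAt (prodModel E) x).target) (w : ∀ j, E j) :
    g.coordEndo (Ki.lift i) x e w =
      ContinuousLinearMap.single ℝ E i (coordContra 𝓘(ℝ, E i) Ki.val (x i) (e i)
        ((coordCov (prodModel E) g.val x e w).comp (ContinuousLinearMap.single ℝ E i))) :=
  coordContra_liftTensor i Ki he _

lemma endoAt_lift (g : Metric (prodModel E) (∀ j, M j)) (i : ι) (Ki : SymTensor 𝓘(ℝ, E i) (M i))
    (x : ∀ j, M j) (w : ∀ j, E j) :
    g.endoAt (Ki.lift i) x w =
      ContinuousLinearMap.single ℝ E i (coordContra 𝓘(ℝ, E i) Ki.val (x i)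
        (extChartAt 𝓘(ℝ, E i) (x i) (x i))
        ((g.coordAt x w).comp (ContinuousLinearMap.single ℝ E i))) :=
  g.coordEndo_lift i Ki (mem_extChartAt_target x) w

lemma endoDeriv_lift_single (g : Metric (prodModel E) (∀ j, M j)) {i j : ι} (hij : i ≠ j)
    (Ki : SymTensor 𝓘(ℝ, E i) (M i)) (x : ∀ j, M j) (z : E j) (w : ∀ j, E j) :
    g.endoDeriv (Ki.lift i) x (Pi.single j z) w =
      ContinuousLinearMap.single ℝ E i (coordContra 𝓘(ℝ, E i) Ki.val (x i)
        (extChartAt 𝓘(ℝ, E i) (x i) (x i))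
        ((g.coordDeriv x (Pi.single j z) w).comp (ContinuousLinearMap.single ℝ E i))) := by
  have hev : (fun e => g.coordEndo (Ki.lift i) x e w) =ᶠ[𝓝 (extChartAt (prodModel E) x x)]
      fun e => ContinuousLinearMap.single ℝ E i (coordContra 𝓘(ℝ, E i) Ki.val (x i) (e i)
        ((coordCov (prodModel E) g.val x e w).comp (ContinuousLinearMap.single ℝ E i))) := by
    filter_upwards [extChartAt_target_mem_nhds x] with e he
    exact g.coordEndo_lift i Ki he w
  have hleft := (g.hasFDerivAt_coordEndo (Ki.lift i) x).clm_apply (hasFDerivAt_const w _)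
  have hKi := (differentiableAt_of_contDiffOn_target (Ki.smooth (x i))).hasFDerivAt.comp
    (extChartAt (prodModel E) x x) (f := fun e : ∀ j, E j => e i)
    (ContinuousLinearMap.proj (R := ℝ) (φ := E) i).hasFDerivAt
  have hg := (ContinuousLinearMap.precomp ℝ (ContinuousLinearMap.single ℝ E i)).hasFDerivAt.comp
    (extChartAt (prodModel E) x x) ((g.hasFDerivAt_coordCov x).clm_apply (hasFDerivAt_const w _))
  have hright := (ContinuousLinearMap.single ℝ E i).hasFDerivAt.comp _ (hKi.clm_apply hg)
  have h := DFunLike.congr_fun ((hleft.congr_of_eventuallyEq hev.symm).unique hright)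
    (Pi.single j z)
  simp only [add_apply, ContinuousLinearMap.comp_apply, ContinuousLinearMap.flip_apply,
    ContinuousLinearMap.proj_apply, Pi.single_eq_of_ne hij, map_zero, zero_apply, zero_add,
    add_zero] at h
  exact h

end Metric

end Pi

section PartialForm

variable {ι : Type*} [Fintype ι] [DecidableEq ι]
  {E : ι → Type*} [∀ j, NormedAddCommGroup (E j)] [∀ j, NormedSpace ℝ (E j)]
  {M : ι → Type*} [∀ j, TopologicalSpace (M j)] [∀ j, ChartedSpace (E j) (M j)]

/-- The component along the factor `M i` of the one-form `η` on the product; its values are taken in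
the model space `E i`, so that they can be compared at different points. -/
def partialForm (i : ι) (η : ∀ p : ∀ j, M j, TangentSpace (prodModel E) p →L[ℝ] ℝ)
    (p : ∀ j, M j) : E i →L[ℝ] ℝ :=
  (η p : (∀ j, E j) →L[ℝ] ℝ).comp (ContinuousLinearMap.single ℝ E i)

lemma liftTensor_leafMap (p : ∀ j, M j) (i : ι) (Ki : SymTensor 𝓘(ℝ, E i) (M i)) (q : M i)
    (α : TangentSpace (prodModel E) (leafMap p i q) →L[ℝ] ℝ) :
    liftTensor i Ki (leafMap p i q) α =
      leafMapD E p i q (Ki.val q (α.comp (leafMapD E p i q))) := by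
  have hKi : ∀ q', q' = q → (Ki.val q' : (E i →L[ℝ] ℝ) →L[ℝ] E i) = Ki.val q := by
    rintro _ rfl
    rfl
  have hincl : (factorIncl E (leafMap p i q) i : E i →L[ℝ] ∀ j, E j) = leafMapD E p i q :=
    (factorIncl_eq_single _ i).trans (leafMapD_eq_single p i q).symm
  refine (DFunLike.congr_fun hincl _).trans (congrArg _ ?_)
  refine (DFunLike.congr_fun (hKi (leafMap p i q i) (Function.update_self i q p)) _).trans ?_
  exact congrArg (fun ν => Ki.val q (ContinuousLinearMap.comp (α : (∀ j, E j) →L[ℝ] ℝ) ν)) hincl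

lemma partialForm_kdV_liftTensor_leafMap {g : Metric (prodModel E) (∀ j, M j)} {i : ι}
    {pbar : ∀ j, M j} {gi : Metric 𝓘(ℝ, E i) (M i)} {c : ℝ}
    (hgi : ∀ (q : M i) (u v : TangentSpace 𝓘(ℝ, E i) q),
      g.val (leafMap pbar i q) (leafMapD E pbar i q u) (leafMapD E pbar i q v) = c * gi.val q u v)
    (Ki : SymTensor 𝓘(ℝ, E i) (M i)) {V : (∀ j, M j) → ℝ}
    (hV : MDifferentiable (prodModel E) 𝓘(ℝ, ℝ) V) (q : M i) (u : E i) :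
    partialForm i (g.kdV (liftTensor i Ki) V) (leafMap pbar i q) u =
      c * gi.kdV Ki.val (V ∘ leafMap pbar i) q u := by
  have hdiff : diff 𝓘(ℝ, E i) (V ∘ leafMap pbar i) q =
      (diff (prodModel E) V (leafMap pbar i q)).comp (leafMapD E pbar i q) :=
    mfderiv_comp q (hV _) (hasMFDerivAt_leafMap pbar i q).mdifferentiableAt
  refine Eq.trans ?_ (hgi q (Ki.val q (diff 𝓘(ℝ, E i) (V ∘ leafMap pbar i) q)) u)
  change g.val _ (liftTensor i Ki _ _) (Pi.single i u : ∀ j, E j) = _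
  rw [liftTensor_leafMap, ← hdiff]
  exact congrArg _ (DFunLike.congr_fun (leafMapD_eq_single pbar i q) u).symm

variable [∀ j, IsManifold 𝓘(ℝ, E j) 1 (M j)]

lemma coordForm_update_comp_single (η : ∀ p : ∀ j, M j, TangentSpace (prodModel E) p →L[ℝ] ℝ)
    (x : ∀ j, M j) {i j : ι} (hij : i ≠ j) {e : E j}
    (he : e ∈ (extChartAt 𝓘(ℝ, E j) (x j)).target) :
    (coordForm (prodModel E) η x (Function.update (extChartAt (prodModel E) x x) j e)).comp
      (ContinuousLinearMap.single ℝ E i) =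
    partialForm i η (leafMap x j ((extChartAt 𝓘(ℝ, E j) (x j)).symm e)) := by
  have hmem : Function.update (extChartAt (prodModel E) x x) j e ∈
      (extChartAt (prodModel E) x).target := by
    refine mem_extChartAt_pi_target.2 fun k => ?_
    obtain rfl | hk := eq_or_ne k j
    · rwa [Function.update_self]
    · rw [Function.update_of_ne hk]
      exact mem_extChartAt_pi_target.1 (mem_extChartAt_target x) k
  have hself : ∀ e' : E i, e' = extChartAt 𝓘(ℝ, E i) (x i) (x i) → ∀ v : E i,
      (chartSymmD 𝓘(ℝ, E i) (x i) e' v : E i) = v := by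
    rintro _ rfl v
    exact chartSymmD_self (I := 𝓘(ℝ, E i)) (x i) v
  ext v
  rw [← extChartAt_pi_symm_update]
  exact congrArg (η _) ((chartSymmD_single hmem i v).trans
    (congrArg (Pi.single (M := E) i) (hself _ (Function.update_of_ne hij _ _) v)))

lemma hasMFDerivAt_partialForm_leafMap
    {η : ∀ p : ∀ j, M j, TangentSpace (prodModel E) p →L[ℝ] ℝ} {x : ∀ j, M j}
    (hη : DifferentiableAt ℝ (coordForm (prodModel E) η x) (extChartAt (prodModel E) x x))
    {i j : ι} (hij : i ≠ j) :
    HasMFDerivAt 𝓘(ℝ, E j) 𝓘(ℝ, E i →L[ℝ] ℝ) (partialForm i η ∘ leafMap x j) (x j)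
      ((ContinuousLinearMap.precomp ℝ (ContinuousLinearMap.single ℝ E i)).comp
        ((fderiv ℝ (coordForm (prodModel E) η x) (extChartAt (prodModel E) x x)).comp
          (ContinuousLinearMap.single ℝ E j)) : E j →L[ℝ] E i →L[ℝ] ℝ) := by
  have hupdate : HasFDerivAt (fun e => coordForm (prodModel E) η x
      (Function.update (extChartAt (prodModel E) x x) j e)) _ (extChartAt (prodModel E) x x j) :=
    HasFDerivAt.comp (g := coordForm (prodModel E) η x)
      (g' := fderiv ℝ (coordForm (prodModel E) η x) (extChartAt (prodModel E) x x)) _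
      (by rw [Function.update_eq_self]; exact hη.hasFDerivAt) (hasFDerivAt_update_single _ j _)
  have hchart := ((ContinuousLinearMap.precomp ℝ
    (ContinuousLinearMap.single ℝ E i)).hasFDerivAt.comp _ hupdate).congr_of_eventuallyEq <| by
      filter_upwards [extChartAt_target_mem_nhds (I := 𝓘(ℝ, E j)) (x j)] with e he
      exact (coordForm_update_comp_single η x hij he).symm
  refine (hasMFDerivAt_iff_of_boundaryless _).2 ⟨?_, hchart⟩
  refine (hchart.continuousAt.comp (continuousAt_extChartAt (I := 𝓘(ℝ, E j)) (x j))).congr ?_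
  filter_upwards [extChartAt_source_mem_nhds (I := 𝓘(ℝ, E j)) (x j)] with q hq
  exact congrArg (fun q' => partialForm i η (leafMap x j q')) ((extChartAt _ (x j)).left_inv hq)

end PartialForm

section Pullback

variable {ι : Type*} [Fintype ι]
  {E : ι → Type*} [∀ j, NormedAddCommGroup (E j)] [∀ j, NormedSpace ℝ (E j)]
  {M : ι → Type*} [∀ j, TopologicalSpace (M j)] [∀ j, ChartedSpace (E j) (M j)]
  [∀ j, IsManifold 𝓘(ℝ, E j) 1 (M j)] {i : ι} {c : ℝ}
  {η : ∀ p : ∀ j, M j, TangentSpace (prodModel E) p →L[ℝ] ℝ}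
  {ζ : ∀ q : M i, TangentSpace 𝓘(ℝ, E i) q →L[ℝ] ℝ}
  (hpull : ∀ (p : ∀ j, M j) (w : ∀ j, E j), η p w = c * ζ (p i) (w i))
include hpull

lemma fderiv_coordForm_of_eq_pullback {x : ∀ j, M j}
    (hζ : DifferentiableAt ℝ (coordForm 𝓘(ℝ, E i) ζ (x i)) (extChartAt 𝓘(ℝ, E i) (x i) (x i)))
    (u v : ∀ j, E j) :
    fderiv ℝ (coordForm (prodModel E) η x) (extChartAt (prodModel E) x x) u v =
      c * fderiv ℝ (coordForm 𝓘(ℝ, E i) ζ (x i)) (extChartAt 𝓘(ℝ, E i) (x i) (x i)) (u i)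
        (v i) := by
  let pull : (E i →L[ℝ] ℝ) →L[ℝ] (∀ j, E j) →L[ℝ] ℝ :=
    c • ContinuousLinearMap.precomp ℝ (ContinuousLinearMap.proj (R := ℝ) (φ := E) i)
  have hev : coordForm (prodModel E) η x =ᶠ[𝓝 (extChartAt (prodModel E) x x)]
      fun e => pull (coordForm 𝓘(ℝ, E i) ζ (x i) (e i)) := by
    filter_upwards [extChartAt_target_mem_nhds x] with e he
    ext w
    exact (hpull _ (chartSymmD (prodModel E) x e w)).trans
      (congrArg (fun t => c * ζ _ t) (chartSymmD_pi_apply he w i))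
  have hfactor := HasFDerivAt.comp (extChartAt (prodModel E) x x)
    (f := fun e : ∀ j, E j => e i) hζ.hasFDerivAt
    (ContinuousLinearMap.proj (R := ℝ) (φ := E) i).hasFDerivAt
  rw [hev.fderiv_eq]
  exact DFunLike.congr_fun
    (DFunLike.congr_fun (pull.hasFDerivAt.comp _ hfactor).fderiv u) v

lemma extD_of_eq_pullback {x : ∀ j, M j}
    (hζ : DifferentiableAt ℝ (coordForm 𝓘(ℝ, E i) ζ (x i)) (extChartAt 𝓘(ℝ, E i) (x i) (x i)))
    (u v : ∀ j, E j) :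
    extD (prodModel E) η x u v = c * extD 𝓘(ℝ, E i) ζ (x i) (u i) (v i) := by
  refine (extD_eq η x u v).trans (Eq.trans ?_ (congrArg (c * ·) (extD_eq ζ (x i) (u i) (v i))).symm)
  rw [fderiv_coordForm_of_eq_pullback hpull hζ, fderiv_coordForm_of_eq_pullback hpull hζ, mul_sub]

end Pullback

lemma dependsOn_of_hasMFDerivAt_leafMap_zero {ι : Type*} [Finite ι] [DecidableEq ι] {E : ι → Type*}
    [∀ j, NormedAddCommGroup (E j)] [∀ j, NormedSpace ℝ (E j)] {M : ι → Type*}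
    [∀ j, TopologicalSpace (M j)] [∀ j, ChartedSpace (E j) (M j)]
    [∀ j, IsManifold 𝓘(ℝ, E j) 1 (M j)]
    {F : Type*} [NormedAddCommGroup F] [NormedSpace ℝ F]
    {f : (∀ j, M j) → F} {s : Set ι} (hconn : ∀ j ∉ s, PreconnectedSpace (M j))
    (hf : ∀ x, ∀ j ∉ s,
      HasMFDerivAt 𝓘(ℝ, E j) 𝓘(ℝ, F) (f ∘ leafMap x j) (x j) (0 : E j →L[ℝ] F)) :
    DependsOn f s := by
  refine dependsOn_of_forall_update_eq fun p j hj q => ?_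
  have := hconn j hj
  have hderiv : ∀ r, HasMFDerivAt 𝓘(ℝ, E j) 𝓘(ℝ, F) (f ∘ leafMap p j) r (0 : E j →L[ℝ] F) := by
    intro r
    have h := hf (Function.update p j r) j hj
    have hleaf : leafMap (Function.update p j r) j = leafMap p j :=
      funext fun _ => Function.update_idem ..
    rwa [hleaf, Function.update_self] at h
  have hconst := (isLocallyConstant_of_hasMFDerivAt_zero hderiv).apply_eq_of_preconnectedSpace q
    (p j)
  exact hconst.trans (congrArg f (Function.update_eq_self j p))

section Eigennet

variable {ι : Type*} [Fintype ι] [DecidableEq ι]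
  {E : ι → Type*} [∀ j, NormedAddCommGroup (E j)] [∀ j, NormedSpace ℝ (E j)]
  {M : ι → Type*} [∀ j, TopologicalSpace (M j)] [∀ j, ChartedSpace (E j) (M j)]

/-- The eigenspaces of the two-tensor `K` form the product net: `lam j` is a smooth eigenfunction,
with eigenspaces the tangent spaces of the leaves of `M j`. -/
structure HasProductEigennet (g : Metric (prodModel E) (∀ j, M j))
    (K : SymTensor (prodModel E) (∀ j, M j)) (lam : ι → (∀ j, M j) → ℝ) : Prop where
  smooth : ∀ j, ContMDiff (prodModel E) 𝓘(ℝ, ℝ) ∞ (lam j)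
  eigenspace_eq : ∀ j p, Module.End.eigenspace (g.endo K p) (lam j p) = productNet E j p

variable {g : Metric (prodModel E) (∀ j, M j)} {K : SymTensor (prodModel E) (∀ j, M j)}
  {lam : ι → (∀ j, M j) → ℝ}

namespace HasProductEigennet

section Pointwise

variable (h : HasProductEigennet g K lam) {a b : ι} (hab : a ≠ b)
include h hab

lemma eigenvalue_ne {v : E a} (hv : v ≠ 0) (p : ∀ j, M j) : lam a p ≠ lam b p := by
  intro heq
  have hmem := single_mem_productNet a p v
  rw [← h.eigenspace_eq, heq, h.eigenspace_eq] at hmem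
  obtain ⟨w, hw⟩ := mem_productNet.1 hmem
  have hcoord : (Pi.single b w : ∀ j, E j) a = (Pi.single a v : ∀ j, E j) a := congrFun hw a
  rw [Pi.single_eq_same, Pi.single_eq_of_ne hab] at hcoord
  exact hv hcoord.symm

lemma val_eq_zero {p : ∀ j, M j} {u v : TangentSpace (prodModel E) p}
    (hu : u ∈ productNet E a p) (hv : v ∈ productNet E b p) : g.val p u v = 0 := by
  obtain ⟨u₀, hu₀_eq⟩ := mem_productNet.1 hu
  obtain rfl | hu₀ := eq_or_ne u₀ 0
  · rw [← hu₀_eq, Pi.single_zero]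
    exact DFunLike.congr_fun (map_zero (g.val p)) v
  rw [← h.eigenspace_eq, Module.End.mem_eigenspace_iff] at hu hv
  have hKu : K.val p (g.val p u) = lam a p • u := hu
  have hKv : K.val p (g.val p v) = lam b p • v := hv
  have hsymm := K.symm p (g.val p u) (g.val p v)
  rw [hKu, hKv, map_smul, map_smul, g.symm p v, smul_eq_mul, smul_eq_mul] at hsymm
  exact (mul_eq_mul_right_iff.1 hsymm).resolve_left (h.eigenvalue_ne hab hu₀ p)

lemma productNet_le_orth (p : ∀ j, M j) : productNet E a p ≤ g.orth (productNet E b) p :=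
  fun _ hu _ hv => h.val_eq_zero hab hu hv

end Pointwise

section Charts

variable [∀ j, IsManifold 𝓘(ℝ, E j) 1 (M j)]

lemma coordCov_single_single (h : HasProductEigennet g K lam) {a b : ι} (hab : a ≠ b)
    {x : ∀ j, M j} {e : ∀ j, E j} (he : e ∈ (extChartAt (prodModel E) x).target)
    (u : E a) (v : E b) :
    coordCov (prodModel E) g.val x e (Pi.single a u) (Pi.single b v) = 0 :=
  h.val_eq_zero hab (chartSymmD_single_mem he a u) (chartSymmD_single_mem he b v)

lemma coordAt_single_single (h : HasProductEigennet g K lam) {a b : ι} (hab : a ≠ b)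
    (x : ∀ j, M j) (u : E a) (v : E b) : g.coordAt x (Pi.single a u) (Pi.single b v) = 0 :=
  h.coordCov_single_single hab (mem_extChartAt_target x) u v

lemma coordDeriv_single_single (h : HasProductEigennet g K lam) {a b : ι} (hab : a ≠ b)
    (x : ∀ j, M j) (Y : ∀ j, E j) (u : E a) (v : E b) :
    g.coordDeriv x Y (Pi.single a u) (Pi.single b v) = 0 := by
  have hev : (fun e => coordCov (prodModel E) g.val x e (Pi.single a u) (Pi.single b v))
      =ᶠ[𝓝 (extChartAt (prodModel E) x x)] fun _ => 0 := by
    filter_upwards [extChartAt_target_mem_nhds x] with e he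
    exact h.coordCov_single_single hab he u v
  exact DFunLike.congr_fun (((g.hasFDerivAt_coordCov_apply x _ _).congr_of_eventuallyEq
    hev.symm).unique (hasFDerivAt_const (0 : ℝ) _)) Y

lemma exists_coordAt_single_ne_zero (h : HasProductEigennet g K lam) (x : ∀ j, M j) {j : ι}
    {z : E j} (hz : z ≠ 0) : ∃ z' : E j, g.coordAt x (Pi.single j z) (Pi.single j z') ≠ 0 := by
  by_contra! hzero
  have hnondeg := g.coordCov_nondegenerate (mem_extChartAt_target x) (Pi.single j z)
  refine hz (Pi.single_eq_zero_iff.1 (hnondeg fun w => ?_))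
  rw [← Finset.univ_sum_single w, map_sum]
  refine Finset.sum_eq_zero fun k _ => ?_
  obtain rfl | hk := eq_or_ne k j
  · exact hzero _
  · exact h.coordAt_single_single hk.symm x z _

lemma coordEndo_single (h : HasProductEigennet g K lam) {x : ∀ j, M j} {e : ∀ j, E j}
    (he : e ∈ (extChartAt (prodModel E) x).target) (a : ι) (u : E a) :
    g.coordEndo K x e (Pi.single a u) =
      lam a ((extChartAt (prodModel E) x).symm e) • (Pi.single a u : ∀ j, E j) := by
  have hmem := chartSymmD_single_mem he a u
  rw [← h.eigenspace_eq, Module.End.mem_eigenspace_iff] at hmem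
  rw [g.coordEndo_apply K he, hmem, map_smul, chartD_chartSymmD he]

lemma endoAt_single (h : HasProductEigennet g K lam) (x : ∀ j, M j) (a : ι) (u : E a) :
    g.endoAt K x (Pi.single a u) = lam a x • (Pi.single a u : ∀ j, E j) := by
  rw [Metric.endoAt, h.coordEndo_single (mem_extChartAt_target x), extChartAt_to_inv]

lemma kdV_lift_apply (h : HasProductEigennet g K lam) {i : ι}
    (Ki : SymTensor 𝓘(ℝ, E i) (M i)) (V : (∀ j, M j) → ℝ) (p : ∀ j, M j) (w : ∀ j, E j) :
    g.kdV (Ki.lift i).val V p w = partialForm i (g.kdV (Ki.lift i).val V) p (w i) := by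
  have hsum := map_sum (g.kdV (Ki.lift i).val V p : (∀ j, E j) →L[ℝ] ℝ)
    (fun j => Pi.single j (w j)) Finset.univ
  rw [Finset.univ_sum_single] at hsum
  refine hsum.trans (Finset.sum_eq_single_of_mem i (Finset.mem_univ i) fun j _ hji => ?_)
  exact h.val_eq_zero hji.symm (LinearMap.mem_range_self _ _) (single_mem_productNet j p (w j))

end Charts

section KillingTensor

variable [∀ j, IsManifold 𝓘(ℝ, E j) ∞ (M j)]

lemma endoDeriv_single (h : HasProductEigennet g K lam) (x : ∀ j, M j) (Y : ∀ j, E j) (a : ι)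
    (u : E a) :
    g.endoDeriv K x Y (Pi.single a u) =
      coordDiff (prodModel E) (lam a) x Y • (Pi.single a u : ∀ j, E j) := by
  have hev : (fun e => g.coordEndo K x e (Pi.single a u))
      =ᶠ[𝓝 (extChartAt (prodModel E) x x)]
      fun e => (lam a ∘ (extChartAt (prodModel E) x).symm) e • (Pi.single a u : ∀ j, E j) := by
    filter_upwards [extChartAt_target_mem_nhds x] with e he
    exact h.coordEndo_single he a u
  have hleft := (g.hasFDerivAt_coordEndo K x).clm_apply
    (hasFDerivAt_const (Pi.single a u : ∀ j, E j) _)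
  have hright := (hasFDerivAt_comp_extChartAt_symm (h.smooth a) x).smul_const
    (Pi.single a u : ∀ j, E j)
  simpa using DFunLike.congr_fun ((hleft.congr_of_eventuallyEq hev.symm).unique hright) Y

variable [∀ j, FiniteDimensional ℝ (E j)]

/-- Compare the parts of the Killing equation that are odd in `z`, for the vectors `u + z`,
`u - z` and `z`. -/
lemma coordDiff_mul_coordAt_self (h : HasProductEigennet g K lam) (hK : IsKillingTensor g K)
    {a b : ι} (hab : a ≠ b) (x : ∀ j, M j) (u : E a) (z : E b) :
    coordDiff (prodModel E) (lam a) x (Pi.single b z) *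
        g.coordAt x (Pi.single a u) (Pi.single a u) =
      (lam a x - lam b x) * g.coordDeriv x (Pi.single b z) (Pi.single a u) (Pi.single a u) := by
  have hadd := hK.coord_eq x (Pi.single a u + Pi.single b z)
  have hsub := hK.coord_eq x (Pi.single a u - Pi.single b z)
  have hz := hK.coord_eq x (Pi.single b z)
  simp only [map_add, map_sub, add_apply, sub_apply, smul_apply, map_smul, h.endoAt_single,
    h.endoDeriv_single, h.coordAt_single_single hab, h.coordAt_single_single hab.symm,
    h.coordDeriv_single_single hab, h.coordDeriv_single_single hab.symm, smul_eq_mul]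
    at hadd hsub hz
  linear_combination (1 / 2) * hadd - (1 / 2) * hsub - hz

/-- The distribution `E_a` is umbilical, its mean curvature being given by the gradient of its
eigenvalue. -/
lemma coordDiff_mul_coordAt (h : HasProductEigennet g K lam) (hK : IsKillingTensor g K)
    {a b : ι} (hab : a ≠ b) (x : ∀ j, M j) (u u' : E a) (z : E b) :
    coordDiff (prodModel E) (lam a) x (Pi.single b z) *
        g.coordAt x (Pi.single a u) (Pi.single a u') =
      (lam a x - lam b x) * g.coordDeriv x (Pi.single b z) (Pi.single a u) (Pi.single a u') := by
  have hadd := h.coordDiff_mul_coordAt_self hK hab x (u + u') z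
  simp only [Pi.single_add, map_add, add_apply, h.coordDiff_mul_coordAt_self hK hab, mul_add,
    g.coordAt_symm x (Pi.single a u') (Pi.single a u),
    g.coordDeriv_symm x _ (Pi.single a u') (Pi.single a u)] at hadd
  linear_combination (1 / 2) * hadd

variable {i j : ι} (hji : j ≠ i) (hgeo : IsGeodesic g (g.orth (productNet E i)))
include hji hgeo

lemma coordDeriv_eq_zero_of_isGeodesic (h : HasProductEigennet g K lam) (x : ∀ j, M j) (u : E i)
    (z z' : E j) : g.coordDeriv x (Pi.single i u) (Pi.single j z) (Pi.single j z') = 0 := by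
  have hx := mem_extChartAt_source (I := prodModel E) x
  have hsection : ∀ y : E j, IsSectionOn (g.orth (productNet E i))
      (extChartAt (prodModel E) x).source
      (coordField (prodModel E) x (Pi.single j y : ∀ j, E j)) := fun y =>
    ⟨smoothVecOn_coordField _ _, fun p hp =>
      h.productNet_le_orth hji p (coordField_single_mem hp j y)⟩
  have horth := hgeo _ _ _ (isOpen_extChartAt_source x) (hsection z) (hsection z') x hx _
    (coordField_single_mem hx i u)
  rw [g.val_covDeriv_coordField, h.coordDeriv_single_single hji,
    h.coordDeriv_single_single hji] at horth
  linarith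

lemma coordDiff_eq_zero_of_isGeodesic (h : HasProductEigennet g K lam) (hK : IsKillingTensor g K)
    (x : ∀ j, M j) (u : E i) {z : E j} (hz : z ≠ 0) :
    coordDiff (prodModel E) (lam j) x (Pi.single i u) = 0 := by
  obtain ⟨z', hz'⟩ := h.exists_coordAt_single_ne_zero x hz
  have hconf := h.coordDiff_mul_coordAt hK hji x z z' u
  rw [h.coordDeriv_eq_zero_of_isGeodesic hji hgeo, mul_zero] at hconf
  exact (mul_eq_zero.1 hconf).resolve_right hz'

lemma sub_mul_coordHess (h : HasProductEigennet g K lam) (hK : IsKillingTensor g K)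
    {V : (∀ j, M j) → ℝ} (hV : ContMDiff (prodModel E) 𝓘(ℝ, ℝ) ∞ V) (hKV : DKdV g K.val V)
    (x : ∀ j, M j) (u : E i) {z : E j} (hz : z ≠ 0) :
    (lam i x - lam j x) * coordHess (prodModel E) V x (Pi.single j z) (Pi.single i u) =
      -(coordDiff (prodModel E) (lam i) x (Pi.single j z) *
        coordDiff (prodModel E) V x (Pi.single i u)) := by
  have heq := hKV.coord_eq hV x (Pi.single i u) (Pi.single j z)
  simp only [h.endoAt_single, h.endoDeriv_single, map_smul, smul_eq_mul,
    h.coordDiff_eq_zero_of_isGeodesic hji hgeo hK x u hz,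
    coordHess_symm hV x (Pi.single i u) (Pi.single j z)] at heq
  linear_combination -heq

end KillingTensor

section Constancy

variable [∀ j, IsManifold 𝓘(ℝ, E j) ∞ (M j)] [∀ j, FiniteDimensional ℝ (E j)]
  (h : HasProductEigennet g K lam) (hK : IsKillingTensor g K)
include h hK

lemma sub_smul_endoDeriv_lift {i j : ι} (hij : i ≠ j)
    (Ki : SymTensor 𝓘(ℝ, E i) (M i)) (x : ∀ j, M j) (u : E i) (z : E j) :
    (lam i x - lam j x) • g.endoDeriv (Ki.lift i) x (Pi.single j z) (Pi.single i u) =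
      coordDiff (prodModel E) (lam i) x (Pi.single j z) •
        g.endoAt (Ki.lift i) x (Pi.single i u) := by
  have hconf : (lam i x - lam j x) • (g.coordDeriv x (Pi.single j z) (Pi.single i u)).comp
        (ContinuousLinearMap.single ℝ E i) =
      coordDiff (prodModel E) (lam i) x (Pi.single j z) •
        (g.coordAt x (Pi.single i u)).comp (ContinuousLinearMap.single ℝ E i) := by
    ext u'
    exact (h.coordDiff_mul_coordAt hK hij x u u' z).symm
  rw [g.endoDeriv_lift_single hij, g.endoAt_lift, ← map_smul, ← map_smul, hconf, map_smul, map_smul]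

variable {i : ι} (hgeo : IsGeodesic g (g.orth (productNet E i))) (Ki : SymTensor 𝓘(ℝ, E i) (M i))
  {V : (∀ j, M j) → ℝ} (hV : ContMDiff (prodModel E) 𝓘(ℝ, ℝ) ∞ V) (hKV : DKdV g K.val V)
include hgeo hV hKV

/-- After multiplication by `lam i - lam j`, the variations of `g` and `dV` cancel. -/
lemma fderiv_coordForm_kdV_lift_single {j : ι} (hij : i ≠ j) (x : ∀ j, M j)
    (u : E i) (z : E j) :
    fderiv ℝ (coordForm (prodModel E) (g.kdV (Ki.lift i).val V) x) (extChartAt (prodModel E) x x)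
      (Pi.single j z) (Pi.single i u) = 0 := by
  obtain rfl | hz := eq_or_ne z 0
  · rw [Pi.single_zero, map_zero, zero_apply]
  obtain ⟨u', hu'⟩ : ∃ u' : E i, g.endoAt (Ki.lift i) x (Pi.single i u) = Pi.single i u' :=
    ⟨_, g.endoAt_lift i Ki x _⟩
  have hhess := h.sub_mul_coordHess hij.symm hgeo hK hV hKV x u' hz
  have hendo := congrArg (coordDiff (prodModel E) V x) (h.sub_smul_endoDeriv_lift hK hij Ki x u z)
  rw [map_smul, map_smul, smul_eq_mul, smul_eq_mul, hu'] at hendo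
  have hne : lam i x - lam j x ≠ 0 := sub_ne_zero.2 (h.eigenvalue_ne hij.symm hz x).symm
  refine (mul_eq_zero.1 ?_).resolve_left hne
  rw [fderiv_coordForm_kdV hV, hu', mul_add, hhess, hendo, neg_add_cancel]

lemma dependsOn_partialForm_kdV_lift
    (hconn : ∀ j ≠ i, PreconnectedSpace (M j)) :
    DependsOn (partialForm i (g.kdV (Ki.lift i).val V)) {i} := by
  refine dependsOn_of_hasMFDerivAt_leafMap_zero (E := E) hconn fun x j hji => ?_
  refine (hasMFDerivAt_partialForm_leafMap (differentiableAt_coordForm_kdV hV g (Ki.lift i) x)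
    (Ne.symm hji)).congr_mfderiv ?_
  ext z u
  exact h.fderiv_coordForm_kdV_lift_single hK hgeo Ki hV hKV (Ne.symm hji) x u z

lemma kdV_lift_eq_pullback (hconn : ∀ j ≠ i, PreconnectedSpace (M j))
    {pbar : ∀ j, M j} {gi : Metric 𝓘(ℝ, E i) (M i)} {c : ℝ}
    (hgi : ∀ (q : M i) (u v : TangentSpace 𝓘(ℝ, E i) q),
      g.val (leafMap pbar i q) (leafMapD E pbar i q u) (leafMapD E pbar i q v) = c * gi.val q u v)
    (p : ∀ j, M j) (w : ∀ j, E j) :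
    g.kdV (Ki.lift i).val V p w = c * gi.kdV Ki.val (V ∘ leafMap pbar i) (p i) (w i) := by
  have hp : ∀ j ∈ ({i} : Set ι), p j = leafMap pbar i (p i) j := by
    rintro _ rfl
    exact (Function.update_self _ _ _).symm
  rw [h.kdV_lift_apply, h.dependsOn_partialForm_kdV_lift hK hgeo Ki hV hKV hconn hp]
  exact partialForm_kdV_liftTensor_leafMap hgi Ki (hV.mdifferentiable (by simp)) (p i) (w i)

end Constancy

end HasProductEigennet

end Eigennet

end PseudoRiem

end

open PseudoRiem in
theorem mainTheorem8_general {ι : Type*} [Fintype ι] [DecidableEq ι]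
    {E : ι → Type*} [∀ j, NormedAddCommGroup (E j)] [∀ j, NormedSpace ℝ (E j)]
    [∀ j, FiniteDimensional ℝ (E j)]
    {M : ι → Type*} [∀ j, TopologicalSpace (M j)] [∀ j, ChartedSpace (E j) (M j)]
    [∀ j, IsManifold 𝓘(ℝ, E j) ∞ (M j)]
    {g : Metric (prodModel E) (∀ j, M j)} {K : SymTensor (prodModel E) (∀ j, M j)}
    (hK : IsKillingTensor g K) {lam : ι → (∀ j, M j) → ℝ} (hnet : HasProductEigennet g K lam)
    {i : ι} (hgeo : IsGeodesic g (g.orth (productNet E i)))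
    (hconn : ∀ j ≠ i, PreconnectedSpace (M j))
    {pbar : ∀ j, M j} {gi : Metric 𝓘(ℝ, E i) (M i)} {c : ℝ} (hc : c ≠ 0)
    (hgi : ∀ (q : M i) (u v : TangentSpace 𝓘(ℝ, E i) q),
      g.val (leafMap pbar i q) (leafMapD E pbar i q u) (leafMapD E pbar i q v) = c * gi.val q u v)
    (Ki : SymTensor 𝓘(ℝ, E i) (M i)) {V : (∀ j, M j) → ℝ}
    (hV : ContMDiff (prodModel E) 𝓘(ℝ, ℝ) ∞ V) (hKV : DKdV g K.val V) :
    DKdV g (liftTensor i Ki) V ↔ DKdV gi Ki.val (V ∘ leafMap pbar i) := by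
  have hext (x : ∀ j, M j) (u v : ∀ j, E j) :
      extD (prodModel E) (g.kdV (Ki.lift i).val V) x u v =
        c * extD 𝓘(ℝ, E i) (gi.kdV Ki.val (V ∘ leafMap pbar i)) (x i) (u i) (v i) :=
    extD_of_eq_pullback (hnet.kdV_lift_eq_pullback hK hgeo Ki hV hKV hconn hgi)
      (differentiableAt_coordForm_kdV (hV.comp (contMDiff_leafMap pbar i)) gi Ki (x i)) u v
  constructor
  · intro hlift q u v
    obtain ⟨x, rfl⟩ : ∃ x : ∀ j, M j, x i = q :=
      ⟨leafMap pbar i q, Function.update_self i q pbar⟩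
    obtain ⟨u, rfl⟩ := Function.surjective_eval (β := E) i u
    obtain ⟨v, rfl⟩ := Function.surjective_eval (β := E) i v
    exact (mul_eq_zero.1 ((hext x u v).symm.trans (hlift x u v))).resolve_left hc
  · intro hfactor x u v
    exact (hext x u v).trans (mul_eq_zero_of_right c (hfactor (x i) _ _))

theorem mainTheorem8
    {ι : Type*} [Fintype ι] [DecidableEq ι]
    {E : ι → Type*} [∀ j, NormedAddCommGroup (E j)] [∀ j, NormedSpace ℝ (E j)]
    [∀ j, FiniteDimensional ℝ (E j)] [∀ j, Nontrivial (E j)]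
    {M : ι → Type*} [∀ j, TopologicalSpace (M j)] [∀ j, ChartedSpace (E j) (M j)]
    [∀ j, IsManifold 𝓘(ℝ, E j) ∞ (M j)]
    -- `M = ∏ j, M j` is connected, with a pseudo-Riemannian metric `g`
    [ConnectedSpace (∀ j, M j)]
    (g : PseudoRiem.Metric (PseudoRiem.prodModel E) (∀ j, M j))
    -- `K` is a Killing tensor whose eigenspaces form the product net, with eigenfunctions `lam j`
    (K : PseudoRiem.SymTensor (PseudoRiem.prodModel E) (∀ j, M j))
    (hK : PseudoRiem.IsKillingTensor g K)
    (lam : ι → (∀ j, M j) → ℝ)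
    (hlam : ∀ j, ContMDiff (PseudoRiem.prodModel E) 𝓘(ℝ, ℝ) ∞ (lam j))
    (hnet : ∀ j p, Module.End.eigenspace (g.endo K p) (lam j p) = PseudoRiem.productNet E j p)
    -- the eigenspace `E_i` is Killing
    (i : ι) (hi : PseudoRiem.IsKillingDistribution g (PseudoRiem.productNet E i))
    -- `gi` is the metric of the factor `M i`: up to a positive constant factor, it is the metric
    -- induced on the leaf of `M i` through `pbar`
    (pbar : ∀ j, M j) (gi : PseudoRiem.Metric 𝓘(ℝ, E i) (M i)) (c : ℝ) (hc : 0 < c)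
    (hgi : ∀ (q : M i) (u v : TangentSpace 𝓘(ℝ, E i) q),
      g.val (PseudoRiem.leafMap pbar i q) (PseudoRiem.leafMapD E pbar i q u)
        (PseudoRiem.leafMapD E pbar i q v) = c * gi.val q u v)
    -- `Ki` is a Killing tensor on the factor `M i`
    (Ki : PseudoRiem.SymTensor 𝓘(ℝ, E i) (M i)) (hKi : PseudoRiem.IsKillingTensor gi Ki)
    (V : (∀ j, M j) → ℝ) (hV : ContMDiff (PseudoRiem.prodModel E) 𝓘(ℝ, ℝ) ∞ V)
    (hKV : PseudoRiem.DKdV g K.val V) :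
    PseudoRiem.DKdV g (PseudoRiem.liftTensor i Ki) V ↔
      PseudoRiem.DKdV gi Ki.val (V ∘ PseudoRiem.leafMap pbar i) := by
  have hconn (j : ι) : ConnectedSpace (M j) := PseudoRiem.connectedSpace_of_pi j
  exact mainTheorem8_general hK ⟨hlam, hnet⟩ hi.2.2 (fun _ _ => inferInstance) hc.ne' hgi Ki hV hKV
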